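/- **Setting.** Let $\mathcal X$ be a countable set, the vertex set of a connected, locally finite (simple, undirected) graph with graph distance $d$; write $x\sim y$ for neighbours. Let $L:\mathcal X\times\mathcal X\to\mathbb R$ be a generator with $L(x,y)>0$ if and only if $x\sim y$, $L(x,y)\ge 0$ for $x\ne y$, $L(x,x)=-\sum_{y\sim x}L(x,y)$ and $\sup_x|L(x,x)|<\infty$, and let $m$ be a measure on $\mathcal X$ with $0<m(x)<\infty$ and $m(x)L(x,y)=m(y)L(y,x)$ for all $x,y$. For a probability measure $q$ and a measure $r$ let $H(q|r)=\int\log(dq/dr)\,dq$ if $q\ll r$ and the integral is finite, and $H(q|r)=+\infty$ otherwise. Let $\Omega$ be the space of right-continuous, piecewise constant paths $\omega:[0,1]\to\mathcal X$ with finitely many jumps, with the cylinder $\sigma$-algebra and the Skorokhod topology, and let $X_t(\omega)=\omega_t$. For a measure $Q$ on $\Omega$ let $Q_t$ be the law of $X_t$ and $Q_{0,1}$ the law of $(X_0,X_1)$ under $Q$. For $\gamma>0$ let $L^\gamma(x,y)=\gamma^{d(x,y)}L(x,y)$ for $x\neq y$ and $L^\gamma(x,x)=-\sum_{y\ne x}L^\gamma(x,y)$,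 and let $R^\gamma$ be the law on $\Omega$ of the Markov jump process with generator $L^\gamma$ and initial (reversible) measure $m$. For probability measures $\nu_0,\nu_1$ on $\mathcal X$ with finite support, let $\widehat Q^\gamma$ be the minimizer of $Q\mapsto H(Q|R^\gamma)$ among the probability measures $Q$ on $\Omega$ with $Q_0=\nu_0$, $Q_1=\nu_1$, and let $\widehat Q^0$ (the limit Schrödinger problem optimizer between $\nu_0$ and $\nu_1$) be the narrow limit of $\widehat Q^\gamma$ as $\gamma\downarrow0$. Put $\widehat\pi^0=\widehat Q^0_{0,1}$. The path $(\widehat Q^0_t)_{t\in[0,1]}$ is the Schrödinger bridge at zero temperature from $\nu_0$ to $\nu_1$. Let $[x,y]$ be the set of vertices lying on geodesics from $x$ to $y$, and let $\nu_t^{0,x,y}$ be the probability measure $$\nu_t^{0,x,y}(z)=\mathbf 1_{[x,y]}(z)\,\frac{L^{d(x,z)}(x,z)\,L^{d(z,y)}(z,y)}{L^{d(x,y)}(x,y)}\binom{d(x,y)}{d(x,z)}t^{d(x,z)}(1-t)^{d(x,y)-d(x,z)},$$ where $L^k(x,y)$ denotes the entries of the $k$-th power of the matrix $L$. **Theorem.**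 For $t\in(0,1)$ let $c_t:\mathcal X\times\mathcal X\to\mathbb R$ be a function, and for $\nu_0,\nu_1$ with finite support put $C_t(\nu_0,\nu_1)=\iint c_t(x,y)\,d\widehat\pi^0(x,y)$. Assume that the relative entropy is $C$-displacement convex: for all probability measures $\nu_0,\nu_1$ on $\mathcal X$ with finite support and all $t\in(0,1)$, $$H(\widehat Q^0_t|m)\le(1-t)H(\nu_0|m)+tH(\nu_1|m)-\frac{t(1-t)}2C_t(\nu_0,\nu_1).$$ Then for every $t\in(0,1)$ and all functions $f,g,h:\mathcal X\to\mathbb R$ satisfying $$(1-t)f(x)+t\,g(y)\le\int h\,d\nu_t^{0,x,y}+\frac{t(1-t)}2c_t(x,y)\qquad\text{for all }x,y\in\mathcal X,$$ one has $$\Big(\int e^f\,dm\Big)^{1-t}\Big(\int e^g\,dm\Big)^{t}\le\int e^h\,dm,$$ where the integrals take values in $(0,+\infty]$. -/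

import Mathlib

open MeasureTheory Set Filter Topology

noncomputable section

namespace ZeroTemp

/-! ### Relative entropy -/

/-- Relative entropy `H(q|r) = ∫ log (dq/dr) dq`, with value `+∞` when `q` is not absolutely
continuous with respect to `r` or when the integral is not finite. -/
def relEntropy {Y : Type*} [MeasurableSpace Y] (q r : Measure Y) : EReal :=
  open Classical in
  if q ≪ r ∧ Integrable (llr q r) q then ((∫ y, llr q r y ∂q : ℝ) : EReal) else ⊤

/-- The measure on a discrete space with point masses `w x`. -/
def pointMeasure {X : Type*} [MeasurableSpace X] (w : X → ℝ) : Measure X :=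
  Measure.sum fun x => ENNReal.ofReal (w x) • Measure.dirac x

/-! ### The discrete space `(X, d, m, L)` -/

/-- A connected, locally finite graph on `X` (its graph distance is the metric `d`), with a
positive measure `m` reversible for a generator `L` of uniformly bounded jump rates, whose positive
entries are exactly those on the edges. -/
structure DiscreteSpace (X : Type*) where
  G : SimpleGraph X
  connected : G.Connected
  finite_neighborSet : ∀ x, (G.neighborSet x).Finite
  m : X → ℝ
  m_pos : ∀ x, 0 < m x
  L : X → X → ℝ
  L_pos_iff : ∀ x y, 0 < L x y ↔ G.Adj x y
  L_nonneg : ∀ x y, x ≠ y → 0 ≤ L x y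
  L_diag : ∀ x, L x x = -∑ y ∈ (finite_neighborSet x).toFinset, L x y
  reversible : ∀ x y, m x * L x y = m y * L y x
  bounded : ∃ S : ℝ, ∀ x, |L x x| ≤ S

variable {X : Type*}

namespace DiscreteSpace

/-- The set of vertices lying on geodesics from `x` to `y`. -/
def interval (𝒳 : DiscreteSpace X) (x y : X) : Set X :=
  {z | ∃ p : 𝒳.G.Walk x y, p.length = 𝒳.G.dist x y ∧ z ∈ p.support}

/-- Entries `L^k(x,y)` of the powers of the generator. -/
def Lpow (𝒳 : DiscreteSpace X) : ℕ → X → X → ℝ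
  | 0, x, y => open Classical in if x = y then 1 else 0
  | k + 1, x, y => 𝒳.L x x * 𝒳.Lpow k x y +
      ∑ z ∈ (𝒳.finite_neighborSet x).toFinset, 𝒳.L x z * 𝒳.Lpow k z y

/-- The point masses `ν_t^{0,x,y}(z)` of the zero-temperature bridge between `δ_x` and `δ_y`. -/
def bridgeMass (𝒳 : DiscreteSpace X) (t : ℝ) (x y z : X) : ℝ :=
  open Classical in
  if z ∈ 𝒳.interval x y then
    𝒳.Lpow (𝒳.G.dist x z) x z * 𝒳.Lpow (𝒳.G.dist z y) z y / 𝒳.Lpow (𝒳.G.dist x y) x y *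
      (((𝒳.G.dist x y).choose (𝒳.G.dist x z) : ℝ) * t ^ 𝒳.G.dist x z *
        (1 - t) ^ (𝒳.G.dist x y - 𝒳.G.dist x z))
  else 0

/-- The zero-temperature bridge `ν_t^{0,x,y}` between `δ_x` and `δ_y`. -/
def bridge [MeasurableSpace X] (𝒳 : DiscreteSpace X) (t : ℝ) (x y : X) : Measure X :=
  pointMeasure (𝒳.bridgeMass t x y)

/-- The generator at temperature `γ`: `L^γ(x,y) = γ^{d(x,y)} L(x,y)` off the diagonal, with
vanishing row sums. -/
def gen (𝒳 : DiscreteSpace X) (γ : ℝ) (x y : X) : ℝ :=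
  open Classical in
  if x = y then -∑ z ∈ (𝒳.finite_neighborSet x).toFinset, γ ^ 𝒳.G.dist x z * 𝒳.L x z
  else γ ^ 𝒳.G.dist x y * 𝒳.L x y

end DiscreteSpace

/-! ### Path space -/

/-- The path on `[0,1]` which takes the value `x k` at time `t` when exactly `k` of the times
`τ i` are at most `t`. -/
def stepFun {n : ℕ} (τ : Fin n → ℝ) (x : Fin (n + 1) → X) (t : unitInterval) : X :=
  x ⟨(Finset.univ.filter fun i => τ i ≤ (t : ℝ)).card,
    Nat.lt_succ_of_le ((Finset.card_filter_le _ _).trans_eq (Finset.card_fin n))⟩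

/-- Right-continuous, piecewise constant paths on `[0,1]` with finitely many jumps. -/
def PathSpace (X : Type*) : Type _ :=
  {ω : unitInterval → X // ∃ (n : ℕ) (τ : Fin n → ℝ) (x : Fin (n + 1) → X), ω = stepFun τ x}

/-- The value `X_t(ω) = ω_t`. -/
def PathSpace.eval (t : unitInterval) (ω : PathSpace X) : X := ω.1 t

/-- The cylinder σ-algebra. -/
instance [MeasurableSpace X] : MeasurableSpace (PathSpace X) :=
  ⨆ t : unitInterval, MeasurableSpace.comap (PathSpace.eval t) inferInstance

/-- Skorokhod balls, for paths with values in a discrete space (where two points at distance less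
than `1` are equal): `ω'` agrees with `ω` up to an increasing change of time which is `ε`-close to
the identity. -/
def skorokhodBall (ω : PathSpace X) (ε : ℝ) : Set (PathSpace X) :=
  {ω' | ∃ l : unitInterval ≃o unitInterval,
    (∃ δ < ε, ∀ t, |((l t : unitInterval) : ℝ) - t| ≤ δ) ∧ ∀ t, ω'.eval (l t) = ω.eval t}

theorem skorokhodBall_mono (ω : PathSpace X) {ε ε' : ℝ} (h : ε ≤ ε') :
    skorokhodBall ω ε ⊆ skorokhodBall ω ε' := by
  rintro ω' ⟨l, ⟨δ, hδ, hl⟩, h'⟩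
  exact ⟨l, ⟨δ, hδ.trans_le h, hl⟩, h'⟩

/-- The Skorokhod topology. -/
instance : TopologicalSpace (PathSpace X) where
  IsOpen U := ∀ ω ∈ U, ∃ ε > 0, skorokhodBall ω ε ⊆ U
  isOpen_univ := fun _ _ => ⟨1, one_pos, subset_univ _⟩
  isOpen_inter := by
    rintro U V hU hV ω ⟨h1, h2⟩
    obtain ⟨a, ha, hUa⟩ := hU ω h1
    obtain ⟨b, hb, hVb⟩ := hV ω h2
    exact ⟨min a b, lt_min ha hb, subset_inter
      ((skorokhodBall_mono ω (min_le_left a b)).trans hUa)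
      ((skorokhodBall_mono ω (min_le_right a b)).trans hVb)⟩
  isOpen_sUnion := by
    rintro s hs ω ⟨U, hU, hω⟩
    obtain ⟨ε, hε, h⟩ := hs U hU ω hω
    exact ⟨ε, hε, h.trans (subset_sUnion_of_mem hU)⟩

/-- Narrow convergence of `Q γ` to `Q₀` as `γ` decreases to `0`. (Continuous functions on path
space are measurable for the cylinder σ-algebra, so that measurability is no restriction.) -/
def NarrowLimit [MeasurableSpace X] (Q : ℝ → ProbabilityMeasure (PathSpace X))
    (Q₀ : ProbabilityMeasure (PathSpace X)) : Prop :=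
  ∀ F : PathSpace X → ℝ, Continuous F → Measurable F → (∃ M, ∀ ω, |F ω| ≤ M) →
    Tendsto (fun γ => ∫ ω, F ω ∂(Q γ : Measure (PathSpace X))) (𝓝[>] 0)
      (𝓝 (∫ ω, F ω ∂(Q₀ : Measure (PathSpace X))))

/-- The law of `X_t` under `Q`. -/
def marginal [MeasurableSpace X] (Q : Measure (PathSpace X)) (t : unitInterval) : Measure X :=
  Q.map (PathSpace.eval t)

/-- The law of `(X_0, X_1)` under `Q`. -/
def endpointLaw [MeasurableSpace X] (Q : Measure (PathSpace X)) : Measure (X × X) :=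
  Q.map fun ω => (ω.eval 0, ω.eval 1)

/-! ### The reference process and Schrödinger bridges -/

namespace DiscreteSpace

variable [MeasurableSpace X]

/-- The reference measure `m`. -/
def refMeasure (𝒳 : DiscreteSpace X) : Measure X := pointMeasure 𝒳.m

/-- Ordered jump times in `(0,1)`. -/
def jumpTimes (n : ℕ) : Set (Fin n → ℝ) := {τ | StrictMono τ ∧ ∀ i, τ i ∈ Ioo (0 : ℝ) 1}

/-- A step function as an element of path space. -/
def stepPath {n : ℕ} (τ : Fin n → ℝ) (x : Fin (n + 1) → X) : PathSpace X :=
  ⟨stepFun τ x, n, τ, x, rfl⟩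

/-- The Markov path measure `R^γ` with generator `L^γ` and initial measure `m`: it gives the
trajectory which jumps successively through `x 0, …, x n` (consecutive states being distinct) at
the times `τ 0 < ⋯ < τ (n - 1)` the density
`m (x 0) ∏ L^γ (x i, x (i+1)) exp (∫₀¹ L^γ (ω_s, ω_s) ds)` with respect to `dτ`. -/
def refPath (𝒳 : DiscreteSpace X) (γ : ℝ) : Measure (PathSpace X) :=
  open Classical in
  Measure.sum fun n : ℕ => Measure.sum fun x : Fin (n + 1) → X =>
    ENNReal.ofReal (𝒳.m (x 0) *
        ∏ i : Fin n, if x i.castSucc = x i.succ then 0 else 𝒳.gen γ (x i.castSucc) (x i.succ)) •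
      (((volume : Measure (Fin n → ℝ)).restrict (jumpTimes n)).withDensity fun τ =>
        ENNReal.ofReal (Real.exp
          (∫ s : unitInterval, 𝒳.gen γ (stepFun τ x s) (stepFun τ x s)))).map
        fun τ => stepPath τ x

/-- `Q` minimizes `H(·|R^γ)` among the path measures with marginals `ν₀`, `ν₁` at times `0`, `1`. -/
def IsSchrodingerOptimizer (𝒳 : DiscreteSpace X) (γ : ℝ) (ν₀ ν₁ : ProbabilityMeasure X)
    (Q : ProbabilityMeasure (PathSpace X)) : Prop :=
  (marginal (Q : Measure (PathSpace X)) 0 = ν₀ ∧ marginal (Q : Measure (PathSpace X)) 1 = ν₁) ∧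
    ∀ Q' : ProbabilityMeasure (PathSpace X),
      marginal (Q' : Measure (PathSpace X)) 0 = ν₀ → marginal (Q' : Measure (PathSpace X)) 1 = ν₁ →
        relEntropy (Q : Measure (PathSpace X)) (𝒳.refPath γ) ≤
          relEntropy (Q' : Measure (PathSpace X)) (𝒳.refPath γ)

/-- `Q₀` is the limit Schrödinger problem optimizer at zero temperature between `ν₀` and `ν₁`: the
narrow limit, as the temperature `γ` decreases to zero, of the optimizers at temperature `γ`. -/
def IsLimitOptimizer (𝒳 : DiscreteSpace X) (ν₀ ν₁ : ProbabilityMeasure X)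
    (Q₀ : ProbabilityMeasure (PathSpace X)) : Prop :=
  ∃ Q : ℝ → ProbabilityMeasure (PathSpace X),
    (∀ γ > 0, 𝒳.IsSchrodingerOptimizer γ ν₀ ν₁ (Q γ)) ∧ NarrowLimit Q Q₀

/-- `ν` has finite support. -/
def FiniteSupport (ν : ProbabilityMeasure X) : Prop := {x | (ν : Measure X) {x} ≠ 0}.Finite

/-- The relative entropy is `C`-displacement convex: for finitely supported `ν₀`, `ν₁`, the
Schrödinger bridge at zero temperature `(Q̂_t)` satisfies, for `t ∈ (0,1)`,
`H(Q̂_t|m) ≤ (1-t) H(ν₀|m) + t H(ν₁|m) - t(1-t)/2 C_t(ν₀,ν₁)`. -/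
def DisplacementConvex (𝒳 : DiscreteSpace X)
    (C : unitInterval → ProbabilityMeasure X → ProbabilityMeasure X → ℝ) : Prop :=
  ∀ ν₀ ν₁ : ProbabilityMeasure X, FiniteSupport ν₀ → FiniteSupport ν₁ →
    ∀ Q₀ : ProbabilityMeasure (PathSpace X), 𝒳.IsLimitOptimizer ν₀ ν₁ Q₀ →
      ∀ t : unitInterval, 0 < t → t < 1 →
        relEntropy (marginal (Q₀ : Measure (PathSpace X)) t) 𝒳.refMeasure ≤
          ((1 - t : ℝ) : EReal) * relEntropy (ν₀ : Measure X) 𝒳.refMeasure +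
            ((t : ℝ) : EReal) * relEntropy (ν₁ : Measure X) 𝒳.refMeasure -
            ((t * (1 - t) / 2 * C t ν₀ ν₁ : ℝ) : EReal)

end DiscreteSpace

end ZeroTemp

end

/-! Displacement convexity is tested on Gibbs measures, and entropy is played against log-partition
functions. For a finite nonempty set K, let ν₀ and ν₁ be the normalizations of e^f m and e^g m on K.
Then H(ν₀|m) = ∫ f dν₀ - log ∫_K e^f dm, and likewise for ν₁ and g, whereas every probability q on a
finite set T satisfies ∫ h dq - H(q|m) ≤ log ∫_T e^h dm. The limit optimizer is a mixture of
zero-temperature bridges whose weights π couple ν₀ and ν₁, so its marginal at time t integrates h to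
the π-average of ∫ h dν_t^{0,x,y}. Averaging the hypothesis on f, g, h over π and inserting
convexity, the linear terms and the cost c cancel. What remains is (1-t) log ∫_K e^f dm + t log ∫_K
e^g dm ≤ log ∫_T e^h dm (`exists_finset_log_partitionFun_le`), and K then exhausts the space.

Convexity only speaks about limit optimizers, so most of the work is to construct one and to
describe it (`exists_isLimitOptimizer`). This rests on three facts.

Static reduction: grouping paths by their endpoints, H(Q|R^γ) is at least the discrete entropy of
the endpoint weights, with equality for mixtures of conditioned copies of R^γ
(`discreteEntropy_le_relEntropy`, `relEntropy_mixture`). The dynamic problem thus becomes a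
finite-dimensional one over couplings on K × K.

Limit of the weights: the R^γ-mass of paths from x to y is asymptotic to a(x,y) γ^{d(x,y)}. The
discrete entropy is therefore a convergent term plus -log γ times the transport cost of d.
Minimizers converge to the entropy minimizer among cost-optimal couplings, unique by strict
convexity (`exists_tendsto_minimizers`).

Limit of the bridges: since L^γ = γ L, the measure R^γ is, up to a density between e^{-γS} and 1, a
power series in γ whose n-th coefficient carries the paths with n jumps. Between x and y the first
nonzero coefficient is n = d(x,y), so conditioned laws converge to that coefficient conditioned. Its
time marginals follow from Chapman–Kolmogorov and the volumes of sets of ordered jump times, which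
produce the binomial factor of ν_t^{0,x,y} (`zeroBridgeLaw_eval`). -/

noncomputable section

namespace ZeroTemp

/-! ### Entropy of mixtures of conditioned measures -/

/-- The relative entropy `∑ p log (p / r)` of weights on a finite type. -/
def discreteEntropy {ι : Type*} [Fintype ι] (r p : ι → ℝ) : ℝ :=
  ∑ i, (p i * Real.log (p i) - p i * Real.log (r i))

section Entropy

variable {Ω : Type*} [MeasurableSpace Ω]

/-- Jensen's inequality for the restrictions of Q and R to one cell, whose mutual density is still
dQ/dR there. The mass corrections in `klDiv` of finite measures occur on both sides and cancel. -/
theorem mul_log_sub_mul_log_le_setIntegral_llr (Q R : Measure Ω) [IsProbabilityMeasure Q]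
    [SigmaFinite R] (hac : Q ≪ R) (hint : Integrable (llr Q R) Q) {E : Set Ω}
    (hE : MeasurableSet E) (hR0 : R E ≠ 0) (hR : R E ≠ ⊤) :
    Q.real E * Real.log (Q.real E) - Q.real E * Real.log (R.real E) ≤
      ∫ ω in E, llr Q R ω ∂Q := by
  have hfin : IsFiniteMeasure (R.restrict E) := ⟨by simpa using hR.lt_top⟩
  have hac' : Q.restrict E ≪ R.restrict E := hac.restrict E
  have hrn : (Q.restrict E).rnDeriv (R.restrict E) =ᵐ[R.restrict E] Q.rnDeriv R := by
    have h : Q.restrict E = (R.restrict E).withDensity (Q.rnDeriv R) := by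
      conv_lhs => rw [← Measure.withDensity_rnDeriv_eq Q R hac]
      rw [restrict_withDensity hE]
    rw [h]
    exact Measure.rnDeriv_withDensity _ (Measure.measurable_rnDeriv Q R)
  have hllr : llr (Q.restrict E) (R.restrict E) =ᵐ[Q.restrict E] llr Q R := by
    filter_upwards [hac'.ae_le hrn] with ω hω
    simp only [llr_def, hω]
  have hint' : Integrable (llr (Q.restrict E) (R.restrict E)) (Q.restrict E) :=
    (integrable_congr hllr).2 hint.restrict
  have key := InformationTheory.mul_log_le_toReal_klDiv hac' hint'
  rw [InformationTheory.toReal_klDiv hac' hint', integral_congr_ae hllr] at key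
  simp only [measureReal_restrict_apply_univ] at key
  have hr : 0 < R.real E := ENNReal.toReal_pos hR0 hR
  rcases eq_or_ne (Q.real E) 0 with h0 | h0
  · rw [h0] at key ⊢
    linarith
  · rw [Real.log_div h0 hr.ne'] at key
    linarith

/-- Coarse-graining decreases entropy: sum the one-cell bounds. It is applied with cells of paths
sharing their endpoints, and with singletons of X. -/
theorem discreteEntropy_le_relEntropy {ι : Type*} [Fintype ι] (Q R : Measure Ω)
    [IsProbabilityMeasure Q] [SigmaFinite R] (E : ι → Set Ω) (hE : ∀ i, MeasurableSet (E i))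
    (hdisj : Pairwise (Function.onFun Disjoint E)) (hR0 : ∀ i, R (E i) ≠ 0)
    (hR : ∀ i, R (E i) ≠ ⊤) (hQ : ∀ᵐ ω ∂Q, ω ∈ ⋃ i, E i) :
    ((discreteEntropy (fun i => R.real (E i)) (fun i => Q.real (E i)) : ℝ) : EReal) ≤
      relEntropy Q R := by
  unfold relEntropy
  split_ifs with h
  · obtain ⟨hac, hint⟩ := h
    rw [EReal.coe_le_coe_iff]
    have : ∫ ω, llr Q R ω ∂Q = ∑ i, ∫ ω in E i, llr Q R ω ∂Q := by
      rw [← integral_iUnion_fintype hE hdisj (fun i => hint.integrableOn),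
        Measure.restrict_eq_self_of_ae_mem hQ]
    rw [this]
    exact Finset.sum_le_sum fun i _ =>
      mul_log_sub_mul_log_le_setIntegral_llr Q R hac hint (hE i) (hR0 i) (hR i)
  · exact le_top

/-- The mixture, with weights `p i`, of the measures `M i` conditioned on `E i`. -/
def mixture {ι : Type*} [Fintype ι] (p : ι → ℝ) (M : ι → Measure Ω) (E : ι → Set Ω) : Measure Ω :=
  Measure.sum fun i => ENNReal.ofReal (p i) • ProbabilityTheory.cond (M i) (E i)

theorem mixture_apply {ι : Type*} [Fintype ι] (p : ι → ℝ) (M : ι → Measure Ω) (E : ι → Set Ω)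
    (s : Set Ω) :
    mixture p M E s = ∑ i, ENNReal.ofReal (p i) * ProbabilityTheory.cond (M i) (E i) s := by
  simp [mixture]

theorem isProbabilityMeasure_mixture {ι : Type*} [Fintype ι] {p : ι → ℝ} {M : ι → Measure Ω}
    {E : ι → Set Ω} (hM0 : ∀ i, M i (E i) ≠ 0) (hM : ∀ i, M i (E i) ≠ ⊤) (hp : ∀ i, 0 ≤ p i)
    (hsum : ∑ i, p i = 1) : IsProbabilityMeasure (mixture p M E) := by
  constructor
  rw [mixture_apply]
  have (i : ι) : ProbabilityTheory.cond (M i) (E i) univ = 1 :=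
    (ProbabilityTheory.cond_isProbabilityMeasure_of_finite (hM0 i) (hM i)).measure_univ
  simp only [this, mul_one]
  rw [← ENNReal.ofReal_sum_of_nonneg fun i _ => hp i, hsum, ENNReal.ofReal_one]

theorem mixture_apply_of_disjoint {ι : Type*} [Fintype ι] {p : ι → ℝ} {M : ι → Measure Ω}
    {E : ι → Set Ω} (hE : ∀ i, MeasurableSet (E i))
    (hdisj : Pairwise (Function.onFun Disjoint E)) (hM0 : ∀ i, M i (E i) ≠ 0)
    (hM : ∀ i, M i (E i) ≠ ⊤) (i : ι) :
    mixture p M E (E i) = ENNReal.ofReal (p i) := by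
  classical
  rw [mixture_apply, Finset.sum_eq_single i]
  · rw [ProbabilityTheory.cond_apply_self (hM0 i) (hM i), mul_one]
  · intro j _ hj
    rw [ProbabilityTheory.cond_apply (hE j), (hdisj hj).inter_eq]
    simp
  · simp

theorem ae_mem_iUnion_mixture {ι : Type*} [Fintype ι] {p : ι → ℝ} {M : ι → Measure Ω}
    {E : ι → Set Ω} (hE : ∀ i, MeasurableSet (E i)) :
    ∀ᵐ ω ∂mixture p M E, ω ∈ ⋃ i, E i := by
  rw [ae_iff]
  change mixture p M E (⋃ i, E i)ᶜ = 0
  rw [mixture_apply]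
  refine Finset.sum_eq_zero fun i _ => ?_
  rw [ProbabilityTheory.cond_apply (hE i)]
  have : E i ∩ (⋃ i, E i)ᶜ = ∅ := by
    rw [← disjoint_iff_inter_eq_empty]
    exact disjoint_compl_right_iff_subset.2 (subset_iUnion E i)
  rw [this]
  simp

theorem integral_mixture {ι : Type*} [Fintype ι] {p : ι → ℝ} {M : ι → Measure Ω}
    {E : ι → Set Ω} (hp : ∀ i, 0 ≤ p i) {F : Ω → ℝ}
    (hF : ∀ i, Integrable F (ProbabilityTheory.cond (M i) (E i))) :
    ∫ ω, F ω ∂mixture p M E = ∑ i, p i * ∫ ω, F ω ∂ProbabilityTheory.cond (M i) (E i) := by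
  rw [mixture, Measure.sum_fintype, integral_finsetSum_measure]
  · simp [integral_smul_measure, hp]
  · intro i _
    exact (hF i).smul_measure ENNReal.ofReal_ne_top

/-- Equality case of coarse-graining: the density of the mixture is the constant p i / R (E i) on
each cell, so Jensen loses nothing. -/
theorem relEntropy_mixture {ι : Type*} [Fintype ι] (R : Measure Ω) [SigmaFinite R]
    (E : ι → Set Ω) (hE : ∀ i, MeasurableSet (E i))
    (hdisj : Pairwise (Function.onFun Disjoint E)) (hR0 : ∀ i, R (E i) ≠ 0)
    (hR : ∀ i, R (E i) ≠ ⊤) {p : ι → ℝ} (hp : ∀ i, 0 ≤ p i) (hsum : ∑ i, p i = 1) :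
    relEntropy (mixture p (fun _ => R) E) R =
      ((discreteEntropy (fun i => R.real (E i)) p : ℝ) : EReal) := by
  classical
  set Q := mixture p (fun _ => R) E with hQ
  have hprob : IsProbabilityMeasure Q := isProbabilityMeasure_mixture hR0 hR hp hsum
  have happ (i : ι) : Q.real (E i) = p i := by
    rw [measureReal_def, hQ, mixture_apply_of_disjoint hE hdisj hR0 hR,
      ENNReal.toReal_ofReal (hp i)]
  set ψ : Ω → ENNReal := fun ω =>
    ∑ i, (E i).indicator (fun _ => ENNReal.ofReal (p i) * (R (E i))⁻¹) ω with hψ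
  have hψm : Measurable ψ := Finset.measurable_sum _ fun i _ => measurable_const.indicator (hE i)
  have hQψ : Q = R.withDensity ψ := by
    ext s hs
    rw [hQ, mixture_apply, withDensity_apply _ hs, hψ,
      lintegral_finsetSum _ fun i _ => measurable_const.indicator (hE i)]
    refine Finset.sum_congr rfl fun i _ => ?_
    rw [lintegral_indicator (hE i), ProbabilityTheory.cond_apply (hE i), lintegral_const,
      Measure.restrict_restrict (hE i), Measure.restrict_apply_univ, mul_assoc]
  have hac : Q ≪ R := hQψ ▸ withDensity_absolutelyContinuous R ψ
  have hrn : Q.rnDeriv R =ᵐ[Q] ψ := hac.ae_le (hQψ ▸ Measure.rnDeriv_withDensity R hψm)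
  have hmem : ∀ᵐ ω ∂Q, ω ∈ ⋃ i, E i := ae_mem_iUnion_mixture hE
  have hψE (i : ι) {ω : Ω} (hω : ω ∈ E i) : ψ ω = ENNReal.ofReal (p i) * (R (E i))⁻¹ := by
    rw [hψ]
    dsimp only
    rw [Finset.sum_eq_single i]
    · simp [hω]
    · intro j _ hj
      exact indicator_of_notMem (fun h => disjoint_left.1 (hdisj hj) h hω) _
    · simp
  have hcE (i : ι) : ∀ ω ∈ E i, Q.rnDeriv R ω = ψ ω →
      llr Q R ω = Real.log (p i / R.real (E i)) := by
    intro ω hω h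
    rw [llr_def]
    dsimp only
    rw [h, hψE i hω, ENNReal.toReal_mul, ENNReal.toReal_ofReal (hp i), ENNReal.toReal_inv,
      measureReal_def, div_eq_mul_inv]
  have hllr (i : ι) : ∀ᵐ ω ∂Q.restrict (E i), llr Q R ω = Real.log (p i / R.real (E i)) := by
    rw [ae_restrict_iff' (hE i)]
    filter_upwards [hrn] with ω h hω using hcE i ω hω h
  have hint : Integrable (llr Q R) Q := by
    refine Integrable.of_bound (measurable_llr Q R).aestronglyMeasurable
      (∑ i, |Real.log (p i / R.real (E i))|) ?_
    filter_upwards [hrn, hmem] with ω h hω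
    obtain ⟨i, hi⟩ := mem_iUnion.1 hω
    rw [hcE i ω hi h, Real.norm_eq_abs]
    exact Finset.single_le_sum (f := fun i => |Real.log (p i / R.real (E i))|)
      (fun _ _ => abs_nonneg _) (Finset.mem_univ i)
  rw [relEntropy, if_pos ⟨hac, hint⟩]
  congr 1
  have : ∫ ω, llr Q R ω ∂Q = ∑ i, ∫ ω in E i, llr Q R ω ∂Q := by
    rw [← integral_iUnion_fintype hE hdisj (fun i => hint.integrableOn),
      Measure.restrict_eq_self_of_ae_mem hmem]
  rw [this, discreteEntropy]
  refine Finset.sum_congr rfl fun i _ => ?_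
  rw [integral_congr_ae (hllr i), setIntegral_const, happ, smul_eq_mul]
  rcases eq_or_ne (p i) 0 with h0 | h0
  · simp [h0]
  · have hr : 0 < R.real (E i) := ENNReal.toReal_pos (hR0 i) (hR i)
    rw [Real.log_div h0 hr.ne']
    ring

end Entropy

/-- Gibbs' inequality `∑ p h - H(p|r) ≤ log ∑ r e^h`. -/
theorem sum_mul_sub_discreteEntropy_le {ι : Type*} [Fintype ι] {r p : ι → ℝ} (h : ι → ℝ)
    (hr : ∀ i, 0 < r i) (hp : ∀ i, 0 ≤ p i) (hsum : ∑ i, p i = 1) :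
    ∑ i, p i * h i - discreteEntropy r p ≤ Real.log (∑ i, r i * Real.exp (h i)) := by
  have hne : Nonempty ι := by
    by_contra hcon
    rw [not_nonempty_iff] at hcon
    simp at hsum
  set Z := ∑ i, r i * Real.exp (h i) with hZ
  have hZpos : 0 < Z := Finset.sum_pos (fun i _ => mul_pos (hr i) (Real.exp_pos _))
    Finset.univ_nonempty
  -- This is log u ≤ u - 1 at u = r e^h / (Z p), multiplied by p. After summation the last two terms
  -- cancel, each having total mass one.
  have key (i : ι) : p i * h i - (p i * Real.log (p i) - p i * Real.log (r i)) ≤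
      p i * Real.log Z + r i * Real.exp (h i) / Z - p i := by
    rcases (hp i).eq_or_lt with h0 | h0
    · rw [← h0]
      simp only [zero_mul, sub_zero, zero_add]
      exact div_nonneg (mul_pos (hr i) (Real.exp_pos _)).le hZpos.le
    · have hy : 0 < r i * Real.exp (h i) / (Z * p i) :=
        div_pos (mul_pos (hr i) (Real.exp_pos _)) (mul_pos hZpos h0)
      have := mul_le_mul_of_nonneg_left (Real.log_le_sub_one_of_pos hy) h0.le
      rw [Real.log_div (mul_pos (hr i) (Real.exp_pos _)).ne' (mul_pos hZpos h0).ne',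
        Real.log_mul (hr i).ne' (Real.exp_pos _).ne', Real.log_mul hZpos.ne' h0.ne',
        Real.log_exp] at this
      have e : p i * (r i * Real.exp (h i) / (Z * p i) - 1) =
        r i * Real.exp (h i) / Z - p i := by field_simp
      rw [e] at this
      linarith
  have := Finset.sum_le_sum fun i (_ : i ∈ Finset.univ) => key i
  rw [Finset.sum_sub_distrib, Finset.sum_sub_distrib (g := p), Finset.sum_add_distrib,
    ← Finset.sum_mul, ← Finset.sum_div, hsum, ← hZ, div_self hZpos.ne'] at this
  rw [discreteEntropy]
  linarith

end ZeroTemp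

namespace ZeroTemp

/-! ### Volume of the sets of ordered jump times -/

theorem volume_eq_coord {n : ℕ} {i j : Fin n} (hij : i ≠ j) :
    volume {τ : Fin n → ℝ | τ i = τ j} = 0 := by
  set f : (Fin n → ℝ) →ₗ[ℝ] ℝ :=
    LinearMap.proj (R := ℝ) (φ := fun _ : Fin n => ℝ) i -
      LinearMap.proj (R := ℝ) (φ := fun _ : Fin n => ℝ) j with hf
  have h : {τ : Fin n → ℝ | τ i = τ j} = (LinearMap.ker f : Set (Fin n → ℝ)) := by
    ext τ
    simp [hf, sub_eq_zero]
  rw [h]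
  refine Measure.addHaar_submodule _ _ fun htop => ?_
  have : Pi.single i (1 : ℝ) ∈ LinearMap.ker f := htop ▸ Submodule.mem_top
  simp [hf, hij.symm] at this

theorem measurableSet_strictMono (n : ℕ) : MeasurableSet {τ : Fin n → ℝ | StrictMono τ} := by
  have : {τ : Fin n → ℝ | StrictMono τ} = ⋂ i, ⋂ j, {τ | i < j → τ i < τ j} := by
    ext τ
    simp [StrictMono]
  rw [this]
  refine MeasurableSet.iInter fun i => MeasurableSet.iInter fun j => ?_
  by_cases h : i < j
  · simpa [h] using measurableSet_lt (measurable_pi_apply i) (measurable_pi_apply j)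
  · simp [h]

theorem volume_preimage_perm {n : ℕ} (σ : Equiv.Perm (Fin n)) (s : Set (Fin n → ℝ)) :
    volume ((fun τ : Fin n → ℝ => τ ∘ σ) ⁻¹' s) = volume s := by
  have h := volume_measurePreserving_piCongrLeft (fun _ : Fin n => ℝ) σ.symm
  have e : (fun τ : Fin n → ℝ => τ ∘ σ) =
      MeasurableEquiv.piCongrLeft (fun _ : Fin n => ℝ) σ.symm := by
    funext τ i
    have := MeasurableEquiv.piCongrLeft_apply_apply (β := fun _ : Fin n => ℝ) σ.symm τ (σ i)
    simpa using this.symm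
  rw [e]
  exact h.measure_preimage_equiv s

/-- A symmetric set of times is cut by the order into `n!` pieces of the same volume. -/
theorem factorial_mul_volume_strictMono_inter {n : ℕ} {s : Set (Fin n → ℝ)} (hs : MeasurableSet s)
    (hsymm : ∀ (σ : Equiv.Perm (Fin n)) (τ : Fin n → ℝ), τ ∘ σ ∈ s ↔ τ ∈ s) :
    (n.factorial : ENNReal) * volume ({τ | StrictMono τ} ∩ s) = volume s := by
  have hA := (measurableSet_strictMono n).inter hs
  set A := {τ : Fin n → ℝ | StrictMono τ} ∩ s with hAdef
  have hmeas (σ : Equiv.Perm (Fin n)) : Measurable fun τ : Fin n → ℝ => τ ∘ σ :=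
    measurable_pi_lambda _ fun i => measurable_pi_apply (σ i)
  have hU : volume (⋃ σ : Equiv.Perm (Fin n), (fun τ : Fin n → ℝ => τ ∘ σ) ⁻¹' A) =
      ∑ σ : Equiv.Perm (Fin n), volume A := by
    rw [measure_iUnion _ fun σ => hmeas σ hA, tsum_fintype]
    · exact Finset.sum_congr rfl fun σ _ => volume_preimage_perm σ A
    -- Two increasing rearrangements of the same vector have the same range, hence coincide; the
    -- entries being distinct, the permutations are equal.
    · intro σ ρ hσρ
      rw [Function.onFun, disjoint_left]
      rintro τ ⟨h1, -⟩ ⟨h2, -⟩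
      apply hσρ
      have hinj : Function.Injective τ := by
        have := h1.injective
        have h3 := this.comp σ.symm.injective
        simpa [Function.comp_assoc] using h3
      have hr : range (τ ∘ σ) = range (τ ∘ ρ) := by
        rw [EquivLike.range_comp, EquivLike.range_comp]
      have : τ ∘ σ = τ ∘ ρ := by
        exact (StrictMono.range_inj h1 h2).1 hr
      ext i
      exact congrArg Fin.val (hinj (congrFun this i))
  -- Sorting puts every vector with distinct entries into one of the pieces, and vectors with a
  -- repeated entry are negligible.
  have hae : (⋃ σ : Equiv.Perm (Fin n), (fun τ : Fin n → ℝ => τ ∘ σ) ⁻¹' A) =ᵐ[volume] s := by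
    have hinj : ∀ᵐ τ : Fin n → ℝ, Function.Injective τ := by
      have : ∀ᵐ τ : Fin n → ℝ, ∀ i j, i ≠ j → τ i ≠ τ j := by
        rw [ae_all_iff]
        intro i
        rw [ae_all_iff]
        intro j
        by_cases h : i = j
        · simp [h]
        · filter_upwards [measure_eq_zero_iff_ae_notMem.1 (volume_eq_coord h)] with τ hτ _
          exact hτ
      filter_upwards [this] with τ hτ i j hij
      by_contra hne
      exact hτ i j hne hij
    filter_upwards [hinj] with τ hτ
    refine propext ⟨fun h => ?_, fun h => ?_⟩
    · obtain ⟨σ, h1⟩ := mem_iUnion.1 h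
      exact (hsymm σ τ).1 h1.2
    · refine mem_iUnion.2 ⟨Tuple.sort τ, ?_, (hsymm _ τ).2 h⟩
      exact (Tuple.monotone_sort τ).strictMono_of_injective (hτ.comp (Equiv.injective _))
  rw [← measure_congr hae, hU, Finset.sum_const, Finset.card_univ, Fintype.card_perm,
    Fintype.card_fin, nsmul_eq_mul]

/-- The intersection with `Iio 1` matters only at t = 1: it keeps all coordinates strictly below 1,
so that the boxes exactly cut up the open unit cube for every t in [0,1]. -/
theorem volume_box_filter {n : ℕ} (S : Finset (Fin n)) {t : ℝ} (h0 : 0 ≤ t) (h1 : t ≤ 1) :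
    volume (univ.pi fun i => if i ∈ S then Ioc (0 : ℝ) t ∩ Iio 1 else Ioo t 1) =
      ENNReal.ofReal (t ^ S.card * (1 - t) ^ (n - S.card)) := by
  rw [volume_pi_pi]
  have hI : volume (Ioc (0 : ℝ) t ∩ Iio 1) = ENNReal.ofReal t := by
    apply le_antisymm
    · exact (measure_mono inter_subset_left).trans (by simp)
    · refine le_trans ?_ (measure_mono (s := Ioo 0 t) fun x hx =>
        ⟨⟨hx.1, hx.2.le⟩, hx.2.trans_le h1⟩)
      simp
  have (i : Fin n) : volume (if i ∈ S then Ioc (0 : ℝ) t ∩ Iio 1 else Ioo t 1) =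
      if i ∈ S then ENNReal.ofReal t else ENNReal.ofReal (1 - t) := by
    split_ifs
    · exact hI
    · simp
  simp only [this]
  rw [Finset.prod_ite, Finset.prod_const, Finset.prod_const, ENNReal.ofReal_mul (pow_nonneg h0 _),
    ENNReal.ofReal_pow h0, ENNReal.ofReal_pow (sub_nonneg.2 h1)]
  congr 2
  · simp
  · rw [Finset.filter_not, Finset.card_sdiff_of_subset (Finset.filter_subset _ _)]
    simp

theorem measurable_card_filter_le (n : ℕ) (t : ℝ) :
    Measurable fun τ : Fin n → ℝ => (Finset.univ.filter fun i => τ i ≤ t).card := by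
  simp only [Finset.card_filter]
  refine Finset.measurable_sum _ fun i _ => ?_
  exact Measurable.ite (measurableSet_le (measurable_pi_apply i) measurable_const)
    measurable_const measurable_const

theorem measurableSet_unitBox (n : ℕ) :
    MeasurableSet {τ : Fin n → ℝ | ∀ i, τ i ∈ Ioo (0 : ℝ) 1} := by
  have : {τ : Fin n → ℝ | ∀ i, τ i ∈ Ioo (0 : ℝ) 1} = univ.pi fun _ => Ioo (0 : ℝ) 1 := by
    ext τ
    simp
  rw [this]
  exact MeasurableSet.univ_pi fun _ => measurableSet_Ioo

theorem card_perm_filter_le {n : ℕ} (σ : Equiv.Perm (Fin n)) (τ : Fin n → ℝ) (t : ℝ) :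
    (Finset.univ.filter fun i => (τ ∘ σ) i ≤ t).card =
      (Finset.univ.filter fun i => τ i ≤ t).card := by
  refine Finset.card_bij (fun i _ => σ i) ?_ (fun i _ j _ h => σ.injective h) ?_
  · intro i hi
    simpa using hi
  · intro j hj
    exact ⟨σ.symm j, by simpa using hj, by simp⟩

/-- The volume of the ordered times in `(0,1)`, exactly `k` of which are at most `t`. -/
theorem volume_jumpTimes_inter_card (n k : ℕ) {t : ℝ} (h0 : 0 ≤ t) (h1 : t ≤ 1) :
    volume (DiscreteSpace.jumpTimes n ∩
        {τ | (Finset.univ.filter fun i => τ i ≤ t).card = k}) =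
      ENNReal.ofReal ((n.choose k : ℝ) * t ^ k * (1 - t) ^ (n - k) / n.factorial) := by
  classical
  set B : Set (Fin n → ℝ) := {τ | (∀ i, τ i ∈ Ioo (0 : ℝ) 1) ∧
    (Finset.univ.filter fun i => τ i ≤ t).card = k} with hB
  have hBm : MeasurableSet B :=
    (measurableSet_unitBox n).inter (measurable_card_filter_le n t (measurableSet_singleton k))
  have hBsymm (σ : Equiv.Perm (Fin n)) (τ : Fin n → ℝ) : τ ∘ σ ∈ B ↔ τ ∈ B := by
    rw [hB, mem_ofPred_eq, mem_ofPred_eq, card_perm_filter_le]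
    exact and_congr_left' (σ.forall_congr_right (q := fun i => τ i ∈ Ioo (0 : ℝ) 1))
  have hvolB : volume B = ENNReal.ofReal ((n.choose k : ℝ) * t ^ k * (1 - t) ^ (n - k)) := by
    -- The index S is the set of coordinates that are at most t; this is the origin of the binomial
    -- coefficient.
    have hBU : B = ⋃ S ∈ Finset.powersetCard k (Finset.univ : Finset (Fin n)),
        univ.pi fun i => if i ∈ S then Ioc (0 : ℝ) t ∩ Iio 1 else Ioo t 1 := by
      ext τ
      simp only [hB, mem_ofPred_eq, mem_iUnion, Finset.mem_powersetCard, Finset.subset_univ,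
        true_and, exists_prop, mem_univ_pi]
      constructor
      · rintro ⟨ha, hb⟩
        refine ⟨_, hb, fun i => ?_⟩
        by_cases hi : τ i ≤ t
        · simp [hi, (ha i).1, (ha i).2]
        · simp [hi, (ha i).2, not_le.1 hi]
      · rintro ⟨S, hS, hτ⟩
        have hiff (i : Fin n) : τ i ≤ t ↔ i ∈ S := by
          have := hτ i
          split_ifs at this with h
          · exact ⟨fun _ => h, fun _ => this.1.2⟩
          · exact ⟨fun h' => absurd this.1 (not_lt.2 h'), fun h' => absurd h' h⟩
        refine ⟨fun i => ?_, ?_⟩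
        · have := hτ i
          split_ifs at this with h
          · exact ⟨this.1.1, this.2⟩
          · exact ⟨h0.trans_lt this.1, this.2⟩
        · simp only [hiff]
          simpa using hS
    rw [hBU, measure_biUnion_finset]
    · rw [Finset.sum_congr rfl fun S hS => by
        rw [volume_box_filter S h0 h1, (Finset.mem_powersetCard.1 hS).2]]
      rw [Finset.sum_const, Finset.card_powersetCard, Finset.card_univ, Fintype.card_fin,
        nsmul_eq_mul, mul_assoc, ENNReal.ofReal_mul (Nat.cast_nonneg _), ENNReal.ofReal_natCast]
    · intro S _ T _ hST
      rw [Function.onFun, disjoint_left]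
      intro τ hS hT
      apply hST
      ext i
      have a := hS i (mem_univ i)
      have b := hT i (mem_univ i)
      by_cases hi : i ∈ S <;> by_cases hj : i ∈ T <;> simp [hi, hj] at a b ⊢
      · linarith
      · linarith
    · intro S _
      refine MeasurableSet.univ_pi fun i => ?_
      split_ifs
      · exact measurableSet_Ioc.inter measurableSet_Iio
      · exact measurableSet_Ioo
  have hset : DiscreteSpace.jumpTimes n ∩
      {τ | (Finset.univ.filter fun i => τ i ≤ t).card = k} = {τ | StrictMono τ} ∩ B := by
    ext τ
    simp only [DiscreteSpace.jumpTimes, hB, mem_inter_iff, mem_ofPred_eq]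
    tauto
  have hfac : (n.factorial : ENNReal) ≠ 0 := by exact_mod_cast n.factorial_ne_zero
  have key := factorial_mul_volume_strictMono_inter hBm hBsymm
  rw [hset, ← ENNReal.mul_right_inj hfac (ENNReal.natCast_ne_top _), key, hvolB,
    ← ENNReal.ofReal_natCast, ← ENNReal.ofReal_mul (Nat.cast_nonneg _)]
  congr 1
  have : (n.factorial : ℝ) ≠ 0 := by exact_mod_cast n.factorial_ne_zero
  field_simp

/-- The case t = 1, k = n of the count, where the condition on the number of times is automatic. -/
theorem volume_jumpTimes (n : ℕ) :
    volume (DiscreteSpace.jumpTimes n) = ENNReal.ofReal (1 / n.factorial) := by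
  have h := volume_jumpTimes_inter_card n n (t := 1) zero_le_one le_rfl
  have e : DiscreteSpace.jumpTimes n ∩
      {τ | (Finset.univ.filter fun i => τ i ≤ 1).card = n} = DiscreteSpace.jumpTimes n := by
    refine inter_eq_left.2 fun τ hτ => ?_
    have : ∀ i, τ i ≤ 1 := fun i => (hτ.2 i).2.le
    simp [this]
  rw [e] at h
  simpa using h

end ZeroTemp

namespace ZeroTemp

/-! ### Finite-dimensional entropic optimal transport at zero temperature -/

section ZeroTemperature

variable {ι : Type*} [Fintype ι]

theorem continuous_discreteEntropy (r : ι → ℝ) : Continuous (discreteEntropy r) := by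
  unfold discreteEntropy
  refine continuous_finsetSum _ fun i _ => ?_
  exact (Real.continuous_mul_log.comp (continuous_apply i)).sub
    ((continuous_apply i).mul continuous_const)

/-- The part containing log r is linear, and u log u is strictly convex on the closed half-line, so
vanishing weights are allowed. -/
theorem strictConvexOn_discreteEntropy (r : ι → ℝ) {S : Set (ι → ℝ)} (hconv : Convex ℝ S)
    (hS : ∀ p ∈ S, ∀ i, 0 ≤ p i) : StrictConvexOn ℝ S (discreteEntropy r) := by
  refine ⟨hconv, fun p hp q hq hpq a b ha hb hab => ?_⟩
  simp only [discreteEntropy, Finset.smul_sum, ← Finset.sum_add_distrib]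
  obtain ⟨j, hj⟩ := Function.ne_iff.1 hpq
  refine Finset.sum_lt_sum (fun i _ => ?_) ⟨j, Finset.mem_univ j, ?_⟩
  · have := Real.strictConvexOn_mul_log.convexOn.2 (hS p hp i) (hS q hq i) ha.le hb.le hab
    simp only [Pi.add_apply, Pi.smul_apply, smul_eq_mul] at this ⊢
    linarith
  · have := Real.strictConvexOn_mul_log.2 (hS p hp j) (hS q hq j) hj ha hb hab
    simp only [Pi.add_apply, Pi.smul_apply, smul_eq_mul] at this ⊢
    linarith

/-- Separates the transport cost of d, whose factor -log γ tends to +∞, from an entropy that stays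
bounded as γ ↓ 0. -/
theorem discreteEntropy_eq_of_scaling {r : ι → ℝ} (d : ι → ℕ) {γ : ℝ} (hγ : 0 < γ)
    (hr : ∀ i, 0 < r i) (p : ι → ℝ) :
    discreteEntropy r p =
      discreteEntropy (fun i => r i / γ ^ d i) p + -Real.log γ * ∑ i, p i * d i := by
  simp only [discreteEntropy, Finset.mul_sum, ← Finset.sum_add_distrib]
  refine Finset.sum_congr rfl fun i _ => ?_
  rw [Real.log_div (hr i).ne' (pow_pos hγ _).ne', Real.log_pow]
  ring

/-- As `γ ↓ 0`, minimizers over a compact convex set of `H(·|r γ)`, where `r γ i ~ a i * γ ^ d i`,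
converge to the minimizer of `H(·|a)` among those points which minimize the cost `d`. -/
theorem exists_tendsto_minimizers {S : Set (ι → ℝ)} (hcomp : IsCompact S) (hne : S.Nonempty)
    (hconv : Convex ℝ S) (hS : ∀ p ∈ S, ∀ i, 0 ≤ p i) (r : ℝ → ι → ℝ) (a : ι → ℝ) (d : ι → ℕ)
    (hr : ∀ γ > 0, ∀ i, 0 < r γ i) (ha : ∀ i, 0 < a i)
    (hlim : ∀ i, Tendsto (fun γ => r γ i / γ ^ d i) (𝓝[>] 0) (𝓝 (a i))) :
    ∃ (p : ℝ → ι → ℝ) (p₀ : ι → ℝ), (∀ γ, p γ ∈ S) ∧ p₀ ∈ S ∧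
      (∀ γ, ∀ q ∈ S, discreteEntropy (r γ) (p γ) ≤ discreteEntropy (r γ) q) ∧
      Tendsto p (𝓝[>] 0) (𝓝 p₀) := by
  choose p hpS hpmin using fun γ =>
    hcomp.exists_isMinOn hne (continuous_discreteEntropy (r γ)).continuousOn
  set cost : (ι → ℝ) → ℝ := fun q => ∑ i, q i * d i with hcost
  have hcostc : Continuous cost := by fun_prop
  obtain ⟨q₁, hq₁S, hq₁⟩ := hcomp.exists_isMinOn hne hcostc.continuousOn
  set S₀ : Set (ι → ℝ) := {q ∈ S | cost q ≤ cost q₁} with hS₀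
  have hS₀comp : IsCompact S₀ := hcomp.inter_right (isClosed_le hcostc continuous_const)
  have hS₀conv : Convex ℝ S₀ := by
    have hcc : ConvexOn ℝ S cost := by
      refine ⟨hconv, fun x _ y _ s t _ _ _ => le_of_eq ?_⟩
      simp only [hcost, Pi.add_apply, Pi.smul_apply, smul_eq_mul, Finset.mul_sum,
        ← Finset.sum_add_distrib]
      exact Finset.sum_congr rfl fun i _ => by ring
    exact hcc.convex_le (cost q₁)
  obtain ⟨p₀, hp₀S, hp₀⟩ := hS₀comp.exists_isMinOn ⟨q₁, hq₁S, le_rfl⟩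
    (continuous_discreteEntropy a).continuousOn
  refine ⟨p, p₀, hpS, hp₀S.1, fun γ q hq => hpmin γ hq, ?_⟩
  -- By compactness it suffices that every cluster point q equals p₀; an ultrafilter realizes q as a
  -- genuine limit.
  refine hcomp.tendsto_nhds_of_unique_mapClusterPt (Eventually.of_forall hpS) fun q hqS hq => ?_
  obtain ⟨U, hU, hUq⟩ := mapClusterPt_iff_ultrafilter.1 hq
  have hγpos : ∀ᶠ γ : ℝ in U, 0 < γ := hU self_mem_nhdsWithin
  have hlog : Tendsto (fun γ : ℝ => -Real.log γ) U atTop :=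
    tendsto_neg_atBot_atTop.comp (Real.tendsto_log_nhdsGT_zero.mono_left hU)
  have hent (q' : ℝ → ι → ℝ) (q'' : ι → ℝ) (h : Tendsto q' U (𝓝 q'')) :
      Tendsto (fun γ => discreteEntropy (fun i => r γ i / γ ^ d i) (q' γ)) U
        (𝓝 (discreteEntropy a q'')) := by
    unfold discreteEntropy
    refine tendsto_finsetSum _ fun i _ => ?_
    have hi := tendsto_pi_nhds.1 h i
    exact ((Real.continuous_mul_log.tendsto _).comp hi).sub
      (hi.mul (((hlim i).mono_left hU).log (ha i).ne'))
  have hent_p := hent p q hUq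
  have hent_0 := hent (fun _ => p₀) p₀ tendsto_const_nhds
  have hcost_p : Tendsto (fun γ => cost (p γ)) U (𝓝 (cost q)) := (hcostc.tendsto q).comp hUq
  have hmin : ∀ᶠ γ : ℝ in U, discreteEntropy (fun i => r γ i / γ ^ d i) (p γ) +
      -Real.log γ * cost (p γ) ≤
      discreteEntropy (fun i => r γ i / γ ^ d i) p₀ + -Real.log γ * cost p₀ := by
    filter_upwards [hγpos] with γ hγ
    rw [← discreteEntropy_eq_of_scaling d hγ (hr γ hγ),
      ← discreteEntropy_eq_of_scaling d hγ (hr γ hγ)]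
    exact hpmin γ hp₀S.1
  have hlogpos : ∀ᶠ γ : ℝ in U, 0 < -Real.log γ := hlog.eventually_gt_atTop 0
  -- Dividing the comparison with p₀ by -log γ removes the entropies in the limit: q is
  -- cost-optimal.
  have hqcost : cost q ≤ cost p₀ := by
    have hdiv : Tendsto (fun γ => (discreteEntropy (fun i => r γ i / γ ^ d i) p₀ -
        discreteEntropy (fun i => r γ i / γ ^ d i) (p γ)) / -Real.log γ) U (𝓝 0) :=
      (hent_0.sub hent_p).div_atTop hlog
    have h2 : Tendsto (fun γ => cost p₀ + (discreteEntropy (fun i => r γ i / γ ^ d i) p₀ -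
        discreteEntropy (fun i => r γ i / γ ^ d i) (p γ)) / -Real.log γ) U (𝓝 (cost p₀ + 0)) :=
      tendsto_const_nhds.add hdiv
    rw [add_zero] at h2
    refine le_of_tendsto_of_tendsto hcost_p h2 ?_
    filter_upwards [hmin, hlogpos] with γ h3 h4
    rw [← sub_le_iff_le_add', le_div_iff₀ h4]
    linarith
  -- As p₀ has minimal cost, the cost terms in the same comparison can be dropped before passing to
  -- the limit.
  have hqent : discreteEntropy a q ≤ discreteEntropy a p₀ := by
    refine le_of_tendsto_of_tendsto hent_p hent_0 ?_
    filter_upwards [hmin, hlogpos] with γ h3 h4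
    have h5 : cost p₀ ≤ cost (p γ) := hp₀S.2.trans (hq₁ (hpS γ))
    have h6 := mul_le_mul_of_nonneg_left h5 h4.le
    linarith
  have hqS₀ : q ∈ S₀ := ⟨hqS, hqcost.trans hp₀S.2⟩
  exact (strictConvexOn_discreteEntropy a hS₀conv fun p hp => hS p hp.1).eq_of_isMinOn
    (fun y hy => hqent.trans (hp₀ hy)) hp₀ hqS₀ hp₀S

/-- Weights on a finite product with prescribed marginals. -/
def couplings {κ : Type*} [Fintype κ] (a b : κ → ℝ) : Set (κ × κ → ℝ) :=
  {π | (∀ i, 0 ≤ π i) ∧ (∀ x, ∑ y, π (x, y) = a x) ∧ ∀ y, ∑ x, π (x, y) = b y}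

theorem isCompact_couplings {κ : Type*} [Fintype κ] (a b : κ → ℝ) : IsCompact (couplings a b) := by
  have hclosed : IsClosed (couplings a b) := by
    have : couplings a b = (⋂ i, {π | 0 ≤ π i}) ∩
        ((⋂ x, {π | ∑ y, π (x, y) = a x}) ∩ ⋂ y, {π | ∑ x, π (x, y) = b y}) := by
      ext π
      simp [couplings]
    rw [this]
    refine (isClosed_iInter fun i => isClosed_le continuous_const (continuous_apply i)).inter
      ((isClosed_iInter fun x => isClosed_eq ?_ continuous_const).inter
        (isClosed_iInter fun x => isClosed_eq ?_ continuous_const)) <;> fun_prop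
  refine IsCompact.of_isClosed_subset (isCompact_Icc (a := (0 : κ × κ → ℝ)) (b := fun i => a i.1))
    hclosed fun π hπ => ⟨fun i => hπ.1 i, fun i => ?_⟩
  change π i ≤ a i.1
  rw [← hπ.2.1 i.1]
  exact Finset.single_le_sum (f := fun y => π (i.1, y)) (fun y _ => hπ.1 _) (Finset.mem_univ i.2)

theorem convex_couplings {κ : Type*} [Fintype κ] (a b : κ → ℝ) : Convex ℝ (couplings a b) := by
  intro π hπ ρ hρ s t hs ht hst
  refine ⟨fun i => add_nonneg (mul_nonneg hs (hπ.1 i)) (mul_nonneg ht (hρ.1 i)), fun x => ?_,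
    fun y => ?_⟩
  · simp only [Pi.add_apply, Pi.smul_apply, smul_eq_mul, Finset.sum_add_distrib, ← Finset.mul_sum,
      hπ.2.1, hρ.2.1]
    rw [← add_mul, hst, one_mul]
  · simp only [Pi.add_apply, Pi.smul_apply, smul_eq_mul, Finset.sum_add_distrib, ← Finset.mul_sum,
      hπ.2.2, hρ.2.2]
    rw [← add_mul, hst, one_mul]

theorem couplings_nonempty {κ : Type*} [Fintype κ] {a b : κ → ℝ} (ha : ∀ x, 0 ≤ a x)
    (hb : ∀ x, 0 ≤ b x) (hasum : ∑ x, a x = 1) (hbsum : ∑ x, b x = 1) :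
    (couplings a b).Nonempty :=
  ⟨fun i => a i.1 * b i.2, fun i => mul_nonneg (ha _) (hb _),
    fun x => by simp only [← Finset.mul_sum, hbsum, mul_one],
    fun y => by simp only [← Finset.sum_mul, hasum, one_mul]⟩

theorem sum_eq_one_of_mem_couplings {κ : Type*} [Fintype κ] {a b : κ → ℝ}
    (hasum : ∑ x, a x = 1) {π : κ × κ → ℝ} (hπ : π ∈ couplings a b) : ∑ i, π i = 1 := by
  rw [Fintype.sum_prod_type, ← hasum]
  exact Finset.sum_congr rfl fun x _ => hπ.2.1 x

end ZeroTemperature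

end ZeroTemp

namespace ZeroTemp

variable {X : Type*}

/-! ### Weighted sums over paths of a given length -/

/-- The Kronecker delta. -/
def delta (x y : X) : ENNReal := open Classical in if x = y then 1 else 0

@[simp] theorem delta_self (x : X) : delta x x = 1 := if_pos rfl

theorem delta_of_ne {x y : X} (h : x ≠ y) : delta x y = 0 := if_neg h

theorem delta_ne_zero_iff {x y : X} : delta x y ≠ 0 ↔ x = y := by simp [delta]

theorem delta_mul_delta (x y z : X) : delta x y * delta x z = delta x y * delta y z := by
  by_cases h : x = y
  · rw [h]
  · simp [delta_of_ne h]

theorem tsum_delta_mul (x : X) (f : X → ENNReal) : ∑' y, delta x y * f y = f x := by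
  rw [tsum_eq_single x fun y hy => by rw [delta_of_ne hy.symm, zero_mul], delta_self, one_mul]

theorem delta_mul_apply (x y : X) (f : X → ENNReal) : delta x y * f x = delta x y * f y := by
  by_cases h : x = y
  · rw [h]
  · simp [delta_of_ne h]

namespace DiscreteSpace

variable (𝒳 : DiscreteSpace X)

/-- The jump rates, as extended nonnegative numbers vanishing on the diagonal. -/
def jumpRate (x y : X) : ENNReal := open Classical in if x = y then 0 else ENNReal.ofReal (𝒳.L x y)

/-- The sum over paths of length `n` from `x` to `y` of the products of jump rates. -/
def walkWeight : ℕ → X → X → ENNReal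
  | 0, x, y => delta x y
  | n + 1, x, y => ∑' z, 𝒳.jumpRate x z * walkWeight n z y

/-- The product of the jump rates along a path. -/
def pathWeight {n : ℕ} (p : Fin (n + 1) → X) : ENNReal :=
  ∏ i : Fin n, 𝒳.jumpRate (p i.castSucc) (p i.succ)

theorem pathWeight_cons {n : ℕ} (x : X) (p : Fin (n + 1) → X) :
    𝒳.pathWeight (Fin.cons x p : Fin (n + 2) → X) = 𝒳.jumpRate x (p 0) * 𝒳.pathWeight p := by
  unfold pathWeight
  rw [Fin.prod_univ_succ]
  simp

/-- First-step decomposition with a general functional of the remaining path; it drives both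
inductions on path sums below. -/
theorem tsum_delta_mul_pathWeight_cons {n : ℕ} (x : X) (Φ : (Fin (n + 1) → X) → ENNReal) :
    ∑' p : Fin (n + 2) → X, delta (p 0) x * 𝒳.pathWeight p * Φ (Fin.tail p) =
      ∑' u, 𝒳.jumpRate x u *
        ∑' q : Fin (n + 1) → X, delta (q 0) u * 𝒳.pathWeight q * Φ q := by
  rw [← (Fin.consEquiv fun _ : Fin (n + 2) => X).tsum_eq, ENNReal.tsum_prod']
  have e (a : X) (q : Fin (n + 1) → X) : (Fin.consEquiv fun _ : Fin (n + 2) => X) (a, q) =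
      (Fin.cons a q : Fin (n + 2) → X) := rfl
  simp only [e, Fin.cons_zero, Fin.tail_cons, 𝒳.pathWeight_cons]
  rw [tsum_eq_single x]
  · simp only [delta_self, one_mul, ← ENNReal.tsum_mul_left]
    rw [ENNReal.tsum_comm]
    refine tsum_congr fun q => ?_
    rw [← tsum_delta_mul (q 0) fun u => 𝒳.jumpRate x u * 𝒳.pathWeight q * Φ q]
    exact tsum_congr fun u => by ring
  · intro y hy
    simp [delta_of_ne hy]

theorem tsum_pathWeight (n : ℕ) (x y : X) :
    ∑' p : Fin (n + 1) → X, delta (p 0) x * 𝒳.pathWeight p * delta (p (Fin.last n)) y =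
      𝒳.walkWeight n x y := by
  induction n generalizing x with
  | zero =>
    rw [← (Equiv.funUnique (Fin 1) X).symm.tsum_eq]
    simp only [pathWeight, Finset.univ_eq_empty, Finset.prod_empty, mul_one, walkWeight]
    rw [tsum_eq_single x]
    · simp
    · intro z hz
      simp [delta_of_ne hz]
  | succ n ih =>
    have := 𝒳.tsum_delta_mul_pathWeight_cons x fun q => delta (q (Fin.last n)) y
    simp only [ih] at this
    rw [walkWeight, ← this]
    rfl

/-- Chapman–Kolmogorov decomposition of path sums at an intermediate step. -/
theorem tsum_pathWeight_through {n : ℕ} (k : Fin (n + 1)) (x z y : X) :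
    ∑' p : Fin (n + 1) → X, delta (p 0) x * 𝒳.pathWeight p *
        (delta (p k) z * delta (p (Fin.last n)) y) =
      𝒳.walkWeight k x z * 𝒳.walkWeight (n - k) z y := by
  -- Passage at step 0 is stated for every length because it serves in both cases of the induction
  -- on n.
  have hzero (n : ℕ) (x : X) : ∑' p : Fin (n + 1) → X, delta (p 0) x * 𝒳.pathWeight p *
      (delta (p 0) z * delta (p (Fin.last n)) y) =
      𝒳.walkWeight 0 x z * 𝒳.walkWeight n z y := by
    rw [← 𝒳.tsum_pathWeight n z y, walkWeight, ← ENNReal.tsum_mul_left]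
    refine tsum_congr fun p => ?_
    have := delta_mul_apply x z fun u => delta (p 0) u
    have h2 := delta_mul_delta (p 0) x z
    calc _ = delta (p 0) x * delta (p 0) z * (𝒳.pathWeight p * delta (p (Fin.last n)) y) := by ring
      _ = delta x z * delta (p 0) z * (𝒳.pathWeight p * delta (p (Fin.last n)) y) := by
        rw [h2, mul_comm, ← this, mul_comm (delta x z)]; ring
      _ = _ := by ring
  induction n generalizing x with
  | zero =>
    rw [Fin.eq_zero k]
    exact hzero 0 x
  | succ n ih =>
    refine Fin.cases ?_ (fun j => ?_) k
    · exact hzero (n + 1) x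
    · have := 𝒳.tsum_delta_mul_pathWeight_cons x fun q => delta (q j) z * delta (q (Fin.last n)) y
      simp only [ih] at this
      simp only [Fin.val_succ, walkWeight, Nat.add_sub_add_right]
      rw [← ENNReal.tsum_mul_right]
      simp only [mul_assoc] at this ⊢
      exact this

theorem jumpRate_of_adj {x y : X} (h : 𝒳.G.Adj x y) :
    𝒳.jumpRate x y = ENNReal.ofReal (𝒳.L x y) := if_neg h.ne

theorem L_eq_zero {x y : X} (hne : x ≠ y) (h : ¬ 𝒳.G.Adj x y) : 𝒳.L x y = 0 :=
  le_antisymm (not_lt.1 fun h' => h ((𝒳.L_pos_iff x y).1 h')) (𝒳.L_nonneg x y hne)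

theorem jumpRate_ne_zero_iff {x y : X} : 𝒳.jumpRate x y ≠ 0 ↔ 𝒳.G.Adj x y := by
  by_cases h : x = y
  · simp [jumpRate, h]
  · rw [jumpRate, if_neg h, ← 𝒳.L_pos_iff]
    simp

theorem tsum_jumpRate_mul (x : X) (f : X → ENNReal) : ∑' y, 𝒳.jumpRate x y * f y =
    ∑ y ∈ (𝒳.finite_neighborSet x).toFinset, ENNReal.ofReal (𝒳.L x y) * f y := by
  rw [tsum_eq_sum (s := (𝒳.finite_neighborSet x).toFinset)]
  · refine Finset.sum_congr rfl fun y hy => ?_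
    rw [𝒳.jumpRate_of_adj (by simpa using hy)]
  · intro y hy
    have : 𝒳.jumpRate x y = 0 := by
      by_contra h
      exact hy (by simpa using 𝒳.jumpRate_ne_zero_iff.1 h)
    rw [this, zero_mul]

theorem L_diag_nonpos (x : X) : 𝒳.L x x ≤ 0 := by
  rw [𝒳.L_diag, neg_nonpos]
  exact Finset.sum_nonneg fun y hy => ((𝒳.L_pos_iff x y).2 (by simpa using hy)).le

theorem tsum_jumpRate (x : X) : ∑' y, 𝒳.jumpRate x y = ENNReal.ofReal (-𝒳.L x x) := by
  have := 𝒳.tsum_jumpRate_mul x fun _ => 1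
  simp only [mul_one] at this
  rw [this, 𝒳.L_diag, neg_neg, ENNReal.ofReal_sum_of_nonneg]
  exact fun y hy => ((𝒳.L_pos_iff x y).2 (by simpa using hy)).le

/-- The jump rates out of x sum to -L(x,x) ≤ S, so each step costs at most a factor S. -/
theorem tsum_walkWeight_le {S : ℝ} (hS : ∀ x, |𝒳.L x x| ≤ S) (n : ℕ) (x : X) :
    ∑' y, 𝒳.walkWeight n x y ≤ ENNReal.ofReal S ^ n := by
  induction n generalizing x with
  | zero => simpa [walkWeight] using (tsum_delta_mul x fun _ => 1).le
  | succ n ih =>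
    simp only [walkWeight]
    rw [ENNReal.tsum_comm]
    simp only [ENNReal.tsum_mul_left]
    calc ∑' z, 𝒳.jumpRate x z * ∑' y, 𝒳.walkWeight n z y
        ≤ ∑' z, 𝒳.jumpRate x z * ENNReal.ofReal S ^ n :=
          ENNReal.tsum_le_tsum fun z => mul_le_mul_right (ih z) _
      _ = ENNReal.ofReal (-𝒳.L x x) * ENNReal.ofReal S ^ n := by
          rw [ENNReal.tsum_mul_right, 𝒳.tsum_jumpRate]
      _ ≤ ENNReal.ofReal S * ENNReal.ofReal S ^ n :=
          mul_le_mul_left (ENNReal.ofReal_le_ofReal ((neg_le_abs _).trans (hS x))) _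
      _ = ENNReal.ofReal S ^ (n + 1) := by ring

theorem walkWeight_le {S : ℝ} (hS : ∀ x, |𝒳.L x x| ≤ S) (n : ℕ) (x y : X) :
    𝒳.walkWeight n x y ≤ ENNReal.ofReal S ^ n :=
  (ENNReal.le_tsum y).trans (𝒳.tsum_walkWeight_le hS n x)

theorem walkWeight_ne_top (n : ℕ) (x y : X) : 𝒳.walkWeight n x y ≠ ⊤ := by
  obtain ⟨S, hS⟩ := 𝒳.bounded
  exact ((𝒳.walkWeight_le hS n x y).trans_lt (ENNReal.pow_lt_top ENNReal.ofReal_lt_top)).ne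

theorem dist_le_of_walkWeight_ne_zero {n : ℕ} {x y : X} (h : 𝒳.walkWeight n x y ≠ 0) :
    𝒳.G.dist x y ≤ n := by
  induction n generalizing x with
  | zero =>
    rw [walkWeight, delta_ne_zero_iff] at h
    simp [h]
  | succ n ih =>
    rw [walkWeight, ne_eq, ENNReal.tsum_eq_zero, not_forall] at h
    obtain ⟨z, hz⟩ := h
    obtain ⟨h1, h2⟩ := mul_ne_zero_iff.1 hz
    have h3 := ih h2
    have h4 := SimpleGraph.dist_eq_one_iff_adj.2 (𝒳.jumpRate_ne_zero_iff.1 h1)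
    have h5 := 𝒳.connected.dist_triangle (u := x) (v := z) (w := y)
    omega

theorem walkWeight_eq_zero {n : ℕ} {x y : X} (h : n < 𝒳.G.dist x y) : 𝒳.walkWeight n x y = 0 := by
  by_contra hne
  exact absurd (𝒳.dist_le_of_walkWeight_ne_zero hne) (not_le.2 h)

theorem walkWeight_length_ne_zero {x y : X} (p : 𝒳.G.Walk x y) : 𝒳.walkWeight p.length x y ≠ 0 := by
  induction p with
  | nil => simp [walkWeight]
  | @cons u v w h p ih =>
    rw [SimpleGraph.Walk.length_cons, walkWeight, ne_eq, ENNReal.tsum_eq_zero, not_forall]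
    exact ⟨v, mul_ne_zero (𝒳.jumpRate_ne_zero_iff.2 h) ih⟩

theorem walkWeight_dist_ne_zero (x y : X) : 𝒳.walkWeight (𝒳.G.dist x y) x y ≠ 0 := by
  obtain ⟨p, hp⟩ := 𝒳.connected.exists_walk_length_eq_dist x y
  exact hp ▸ 𝒳.walkWeight_length_ne_zero p

/-- Matrix powers also count steps that stay put, with negative weight. Up to the distance these do
not contribute: a stay leaves too few steps to reach y. -/
theorem Lpow_nonneg_and_walkWeight_eq {k : ℕ} {x y : X} (h : k ≤ 𝒳.G.dist x y) :
    0 ≤ 𝒳.Lpow k x y ∧ 𝒳.walkWeight k x y = ENNReal.ofReal (𝒳.Lpow k x y) := by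
  induction k generalizing x with
  | zero =>
    by_cases hxy : x = y
    · simp [Lpow, walkWeight, hxy]
    · simp [Lpow, walkWeight, hxy, delta_of_ne hxy]
  | succ k ih =>
    have h0 : 𝒳.Lpow k x y = 0 := by
      obtain ⟨h1, h2⟩ := ih (x := x) (by omega)
      rw [𝒳.walkWeight_eq_zero (by omega)] at h2
      exact le_antisymm (ENNReal.ofReal_eq_zero.1 h2.symm) h1
    have hadj {z : X} (hz : z ∈ (𝒳.finite_neighborSet x).toFinset) :
        0 < 𝒳.L x z ∧ 0 ≤ 𝒳.Lpow k z y ∧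
          𝒳.walkWeight k z y = ENNReal.ofReal (𝒳.Lpow k z y) := by
      have hz' : 𝒳.G.Adj x z := by simpa using hz
      have h4 := SimpleGraph.dist_eq_one_iff_adj.2 hz'
      have h5 := 𝒳.connected.dist_triangle (u := x) (v := z) (w := y)
      exact ⟨(𝒳.L_pos_iff x z).2 hz', ih (by omega)⟩
    rw [Lpow, h0, mul_zero, zero_add, walkWeight, tsum_jumpRate_mul, ENNReal.ofReal_sum_of_nonneg]
    · refine ⟨Finset.sum_nonneg fun z hz => mul_nonneg (hadj hz).1.le (hadj hz).2.1,
        Finset.sum_congr rfl fun z hz => ?_⟩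
      rw [ENNReal.ofReal_mul (hadj hz).1.le, (hadj hz).2.2]
    · exact fun z hz => mul_nonneg (hadj hz).1.le (hadj hz).2.1

theorem walkWeight_dist (x y : X) :
    𝒳.walkWeight (𝒳.G.dist x y) x y = ENNReal.ofReal (𝒳.Lpow (𝒳.G.dist x y) x y) :=
  (𝒳.Lpow_nonneg_and_walkWeight_eq le_rfl).2

theorem Lpow_dist_pos (x y : X) : 0 < 𝒳.Lpow (𝒳.G.dist x y) x y := by
  have h := 𝒳.walkWeight_dist_ne_zero x y
  rw [𝒳.walkWeight_dist] at h
  simpa using h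

/-- Replaces geodesics by an equality case of the triangle inequality, the form in which path sums
detect the interval. -/
theorem mem_interval_iff {x y z : X} :
    z ∈ 𝒳.interval x y ↔ 𝒳.G.dist x z + 𝒳.G.dist z y = 𝒳.G.dist x y := by
  classical
  constructor
  · rintro ⟨p, hp, hz⟩
    have h1 := SimpleGraph.dist_le (p.takeUntil z hz)
    have h2 := SimpleGraph.dist_le (p.dropUntil z hz)
    have h3 := 𝒳.connected.dist_triangle (u := x) (v := z) (w := y)
    have h4 : (p.takeUntil z hz).length + (p.dropUntil z hz).length = p.length := by
      rw [← SimpleGraph.Walk.length_append, SimpleGraph.Walk.take_spec]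
    omega
  · intro h
    obtain ⟨p, hp⟩ := 𝒳.connected.exists_walk_length_eq_dist x z
    obtain ⟨q, hq⟩ := 𝒳.connected.exists_walk_length_eq_dist z y
    refine ⟨p.append q, by rw [SimpleGraph.Walk.length_append, hp, hq, h], ?_⟩
    simp

theorem finite_setOf_walkWeight_ne_zero (n : ℕ) (x : X) :
    {z | 𝒳.walkWeight n x z ≠ 0}.Finite := by
  induction n generalizing x with
  | zero =>
    refine (finite_singleton x).subset fun z hz => ?_
    exact (delta_ne_zero_iff.1 hz).symm
  | succ n ih =>
    refine ((𝒳.finite_neighborSet x).biUnion fun u _ => ih u).subset fun z hz => ?_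
    rw [mem_ofPred_eq, walkWeight, ne_eq, ENNReal.tsum_eq_zero, not_forall] at hz
    obtain ⟨u, hu⟩ := hz
    obtain ⟨h1, h2⟩ := mul_ne_zero_iff.1 hu
    exact mem_biUnion (𝒳.jumpRate_ne_zero_iff.1 h1) h2

theorem finite_interval (x y : X) : (𝒳.interval x y).Finite := by
  refine ((finite_Iic (𝒳.G.dist x y)).biUnion fun n _ =>
    𝒳.finite_setOf_walkWeight_ne_zero n x).subset fun z hz => ?_
  rw [mem_interval_iff] at hz
  exact mem_biUnion (x := 𝒳.G.dist x z) (by simp; omega) (𝒳.walkWeight_dist_ne_zero x z)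

theorem bridgeMass_nonneg {t : ℝ} (h0 : 0 ≤ t) (h1 : t ≤ 1) (x y z : X) :
    0 ≤ 𝒳.bridgeMass t x y z := by
  unfold bridgeMass
  have := sub_nonneg.2 h1
  have := 𝒳.Lpow_dist_pos x z
  have := 𝒳.Lpow_dist_pos z y
  have := 𝒳.Lpow_dist_pos x y
  split_ifs
  · positivity
  · exact le_rfl

theorem bridgeMass_eq_zero {t : ℝ} {x y z : X} (h : z ∉ 𝒳.interval x y) :
    𝒳.bridgeMass t x y z = 0 := if_neg h

/-- With only d(x,y) steps available, being at z after k of them forces k = d(x,z) and equality in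
the triangle inequality. At most one term survives, and it is the bridge mass up to normalization.
-/
theorem sum_walkWeight_mul_eq_bridgeMass (t : ℝ) (x y z : X) :
    ∑ k : Fin (𝒳.G.dist x y + 1), 𝒳.walkWeight k x z * 𝒳.walkWeight (𝒳.G.dist x y - k) z y *
        ENNReal.ofReal (((𝒳.G.dist x y).choose k : ℝ) * t ^ (k : ℕ) *
          (1 - t) ^ (𝒳.G.dist x y - k) / (𝒳.G.dist x y).factorial) =
      𝒳.walkWeight (𝒳.G.dist x y) x y * ENNReal.ofReal (1 / (𝒳.G.dist x y).factorial) *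
        ENNReal.ofReal (𝒳.bridgeMass t x y z) := by
  have h3 := 𝒳.connected.dist_triangle (u := x) (v := z) (w := y)
  have hk {k : ℕ} (hk : k < 𝒳.G.dist x y + 1)
      (hne : 𝒳.walkWeight k x z * 𝒳.walkWeight (𝒳.G.dist x y - k) z y ≠ 0) :
      k = 𝒳.G.dist x z ∧ 𝒳.G.dist x z + 𝒳.G.dist z y = 𝒳.G.dist x y := by
    obtain ⟨ha, hb⟩ := mul_ne_zero_iff.1 hne
    have ha' := 𝒳.dist_le_of_walkWeight_ne_zero ha
    have hb' := 𝒳.dist_le_of_walkWeight_ne_zero hb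
    omega
  by_cases hz : z ∈ 𝒳.interval x y
  · have hz' := 𝒳.mem_interval_iff.1 hz
    have hlt : 𝒳.G.dist x z < 𝒳.G.dist x y + 1 := by omega
    have hsub : 𝒳.G.dist x y - 𝒳.G.dist x z = 𝒳.G.dist z y := by omega
    rw [Finset.sum_eq_single ⟨𝒳.G.dist x z, hlt⟩]
    · rw [bridgeMass, if_pos hz]
      dsimp only
      rw [hsub, 𝒳.walkWeight_dist, 𝒳.walkWeight_dist, 𝒳.walkWeight_dist]
      have a1 := 𝒳.Lpow_dist_pos x z
      have a2 := 𝒳.Lpow_dist_pos z y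
      have a3 := 𝒳.Lpow_dist_pos x y
      have a4 : (0 : ℝ) < (𝒳.G.dist x y).factorial := by exact_mod_cast Nat.factorial_pos _
      rw [← ENNReal.ofReal_mul a1.le, ← ENNReal.ofReal_mul (by positivity),
        ← ENNReal.ofReal_mul a3.le, ← ENNReal.ofReal_mul (by positivity)]
      congr 1
      field_simp
    · intro k _ hne
      by_contra hcon
      exact hne (Fin.ext (hk k.2 (mul_ne_zero_iff.1 hcon).1).1)
    · simp
  · rw [𝒳.bridgeMass_eq_zero hz, ENNReal.ofReal_zero, mul_zero]
    refine Finset.sum_eq_zero fun k _ => ?_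
    by_contra hcon
    exact hz (𝒳.mem_interval_iff.2 (hk k.2 (mul_ne_zero_iff.1 hcon).1).2)

/-- Rates live on edges, where d = 1, so lowering the temperature merely slows the process down by
the factor γ. -/
theorem gen_of_ne {γ : ℝ} {x y : X} (h : x ≠ y) : 𝒳.gen γ x y = γ * 𝒳.L x y := by
  rw [gen, if_neg h]
  by_cases hadj : 𝒳.G.Adj x y
  · rw [SimpleGraph.dist_eq_one_iff_adj.2 hadj, pow_one]
  · rw [𝒳.L_eq_zero h hadj, mul_zero, mul_zero]

theorem gen_self (γ : ℝ) (x : X) : 𝒳.gen γ x x = γ * 𝒳.L x x := by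
  rw [gen, if_pos rfl, 𝒳.L_diag, mul_neg, Finset.mul_sum]
  congr 1
  refine Finset.sum_congr rfl fun z hz => ?_
  have : 𝒳.G.Adj x z := by simpa using hz
  rw [SimpleGraph.dist_eq_one_iff_adj.2 this, pow_one]

end DiscreteSpace

end ZeroTemp

namespace ZeroTemp

variable {X : Type*}

/-! ### The reference measure and its expansion in the temperature -/

theorem stepFun_zero {n : ℕ} {τ : Fin n → ℝ} (hτ : τ ∈ DiscreteSpace.jumpTimes n)
    (p : Fin (n + 1) → X) : stepFun τ p 0 = p 0 := by
  unfold stepFun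
  congr 1
  ext
  simpa using fun i => (hτ.2 i).1

theorem stepFun_one {n : ℕ} {τ : Fin n → ℝ} (hτ : τ ∈ DiscreteSpace.jumpTimes n)
    (p : Fin (n + 1) → X) : stepFun τ p 1 = p (Fin.last n) := by
  unfold stepFun
  congr 1
  ext
  have : ∀ i, τ i ≤ 1 := fun i => (hτ.2 i).2.le
  simp [this]

/-- The set of paths from `x` to `y`. -/
def endpointSet (x y : X) : Set (PathSpace X) := {ω | ω.eval 0 = x ∧ ω.eval 1 = y}

theorem disjoint_endpointSet {x y x' y' : X} (h : (x, y) ≠ (x', y')) :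
    Disjoint (endpointSet x y) (endpointSet x' y') := by
  rw [disjoint_left]
  rintro ω ⟨h1, h2⟩ ⟨h3, h4⟩
  exact h (by rw [← h1, ← h2, ← h3, ← h4])

/-! ### Laws of paths through a prescribed sequence of states. -/

section Measurability

variable [MeasurableSpace X]

theorem measurable_eval (t : unitInterval) : Measurable (PathSpace.eval (X := X) t) :=
  measurable_iff_comap_le.2
    (le_iSup (fun t => MeasurableSpace.comap (PathSpace.eval (X := X) t) _) t)

theorem measurable_of_measurable_eval {Y : Type*} [MeasurableSpace Y] {f : Y → PathSpace X}
    (hf : ∀ t, Measurable fun y => (f y).eval t) : Measurable f := by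
  rw [measurable_iff_comap_le]
  change MeasurableSpace.comap f (⨆ t : unitInterval, _) ≤ _
  rw [MeasurableSpace.comap_iSup]
  refine iSup_le fun t => ?_
  rw [MeasurableSpace.comap_comp]
  exact measurable_iff_comap_le.1 (hf t)

theorem measurable_stepPath {n : ℕ} (p : Fin (n + 1) → X) :
    Measurable fun τ => DiscreteSpace.stepPath τ p := by
  refine measurable_of_measurable_eval fun t => ?_
  -- The position at time t depends only on the number of jumps made so far; the default `p 0`
  -- beyond n is never reached.
  have h : (fun τ => (DiscreteSpace.stepPath τ p).eval t) =
      (fun k : ℕ => if h : k < n + 1 then p ⟨k, h⟩ else p 0) ∘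
        fun τ : Fin n → ℝ => (Finset.univ.filter fun i => τ i ≤ t).card := by
    funext τ
    have hlt : (Finset.univ.filter fun i => τ i ≤ (t : ℝ)).card < n + 1 :=
      Nat.lt_succ_of_le ((Finset.card_filter_le _ _).trans_eq (Finset.card_fin n))
    simp only [Function.comp_apply, dif_pos hlt]
    rfl
  rw [h]
  exact measurable_from_top.comp (measurable_card_filter_le n t)

/-- Lebesgue measure on the ordered jump times, carried to the paths which jump successively through
the states `p 0, …, p n`. -/
def jumpLaw {n : ℕ} (p : Fin (n + 1) → X) : Measure (PathSpace X) :=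
  (volume.restrict (DiscreteSpace.jumpTimes n)).map fun τ => DiscreteSpace.stepPath τ p

theorem jumpLaw_apply {n : ℕ} (p : Fin (n + 1) → X) {s : Set (PathSpace X)}
    (hs : MeasurableSet s) :
    jumpLaw p s = volume (DiscreteSpace.jumpTimes n ∩
      (fun τ => DiscreteSpace.stepPath τ p) ⁻¹' s) := by
  rw [jumpLaw, Measure.map_apply (measurable_stepPath p) hs,
    Measure.restrict_apply (measurable_stepPath p hs), inter_comm]

variable [MeasurableSingletonClass X]

theorem measurableSet_endpointSet (x y : X) : MeasurableSet (endpointSet x y) :=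
  (measurable_eval 0 (measurableSet_singleton x)).inter
    (measurable_eval 1 (measurableSet_singleton y))

theorem jumpLaw_endpointSet {n : ℕ} (p : Fin (n + 1) → X) (x y : X) :
    jumpLaw p (endpointSet x y) =
      delta (p 0) x * delta (p (Fin.last n)) y * ENNReal.ofReal (1 / n.factorial) := by
  rw [jumpLaw_apply p (measurableSet_endpointSet x y), ← volume_jumpTimes]
  by_cases h : p 0 = x ∧ p (Fin.last n) = y
  · rw [h.1, h.2, delta_self, delta_self, one_mul, one_mul]
    congr 1
    refine inter_eq_left.2 fun τ hτ => ?_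
    exact ⟨(stepFun_zero hτ p).trans h.1, (stepFun_one hτ p).trans h.2⟩
  · have h0 : delta (p 0) x * delta (p (Fin.last n)) y = 0 := by
      by_contra hcon
      obtain ⟨h1, h2⟩ := mul_ne_zero_iff.1 hcon
      exact h ⟨delta_ne_zero_iff.1 h1, delta_ne_zero_iff.1 h2⟩
    rw [h0, zero_mul]
    convert measure_empty (μ := (volume : Measure (Fin n → ℝ)))
    rw [eq_empty_iff_forall_notMem]
    rintro τ ⟨hτ, h1, h2⟩
    exact h ⟨(stepFun_zero hτ p).symm.trans h1, (stepFun_one hτ p).symm.trans h2⟩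

/-- Split according to the number k of jumps up to time t: the position is then p k, and the
admissible ordered times have the volume computed above. -/
theorem jumpLaw_endpointSet_inter {n : ℕ} (p : Fin (n + 1) → X) (x y z : X) (t : unitInterval) :
    jumpLaw p (endpointSet x y ∩ PathSpace.eval t ⁻¹' {z}) =
      ∑ k : Fin (n + 1), delta (p 0) x * (delta (p k) z * delta (p (Fin.last n)) y) *
        ENNReal.ofReal ((n.choose k : ℝ) * (t : ℝ) ^ (k : ℕ) * (1 - t) ^ (n - k) /
          n.factorial) := by
  have hA : MeasurableSet (endpointSet x y ∩ PathSpace.eval t ⁻¹' {z}) :=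
    (measurableSet_endpointSet x y).inter (measurable_eval t (measurableSet_singleton z))
  rw [jumpLaw_apply p hA]
  set A := DiscreteSpace.jumpTimes n ∩ (fun τ => DiscreteSpace.stepPath τ p) ⁻¹'
    (endpointSet x y ∩ PathSpace.eval t ⁻¹' {z}) with hAdef
  set f : (Fin n → ℝ) → ℕ := fun τ => (Finset.univ.filter fun i => τ i ≤ (t : ℝ)).card with hf
  have hflt (τ : Fin n → ℝ) : f τ < n + 1 :=
    Nat.lt_succ_of_le ((Finset.card_filter_le _ _).trans_eq (Finset.card_fin n))
  have hfm : Measurable f := measurable_card_filter_le n t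
  have hsum := sum_measure_preimage_singleton (μ := volume.restrict A) (f := f)
    (Finset.range (n + 1)) fun k _ => hfm (measurableSet_singleton k)
  have huniv : f ⁻¹' (Finset.range (n + 1) : Set ℕ) = univ := by
    ext τ
    simpa using hflt τ
  rw [huniv, Measure.restrict_apply_univ, Finset.sum_range] at hsum
  rw [← hsum]
  refine Finset.sum_congr rfl fun k _ => ?_
  rw [Measure.restrict_apply (hfm (measurableSet_singleton _)),
    ← volume_jumpTimes_inter_card n k t.2.1 t.2.2]
  have hstep {τ : Fin n → ℝ} (hk : f τ = k) : stepFun τ p t = p k := by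
    unfold stepFun
    congr 1
    exact Fin.ext hk
  by_cases h : p 0 = x ∧ p k = z ∧ p (Fin.last n) = y
  · rw [h.1, h.2.1, h.2.2]
    simp only [delta_self, one_mul]
    congr 1
    ext τ
    constructor
    · rintro ⟨h1, h2, h3⟩
      exact ⟨h2, h1⟩
    · rintro ⟨h1, h2⟩
      exact ⟨h2, h1, ⟨(stepFun_zero h1 p).trans h.1, (stepFun_one h1 p).trans h.2.2⟩,
        (hstep h2).trans h.2.1⟩
  · have h0 : delta (p 0) x * (delta (p k) z * delta (p (Fin.last n)) y) = 0 := by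
      by_contra hcon
      obtain ⟨h1, h2⟩ := mul_ne_zero_iff.1 hcon
      obtain ⟨h2, h3⟩ := mul_ne_zero_iff.1 h2
      exact h ⟨delta_ne_zero_iff.1 h1, delta_ne_zero_iff.1 h2, delta_ne_zero_iff.1 h3⟩
    rw [h0, zero_mul]
    convert measure_empty (μ := (volume : Measure (Fin n → ℝ)))
    rw [eq_empty_iff_forall_notMem]
    rintro τ ⟨hk, hτ, ⟨h1, h2⟩, h3⟩
    exact h ⟨(stepFun_zero hτ p).symm.trans h1, (hstep hk).symm.trans h3,
      (stepFun_one hτ p).symm.trans h2⟩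

end Measurability

namespace DiscreteSpace

variable (𝒳 : DiscreteSpace X)

theorem ofReal_refPath_coeff {γ : ℝ} (hγ : 0 < γ) {n : ℕ} (p : Fin (n + 1) → X) :
    (open Classical in ENNReal.ofReal (𝒳.m (p 0) * ∏ i : Fin n,
        if p i.castSucc = p i.succ then 0 else 𝒳.gen γ (p i.castSucc) (p i.succ))) =
      ENNReal.ofReal γ ^ n * (ENNReal.ofReal (𝒳.m (p 0)) * 𝒳.pathWeight p) := by
  have hnn (i : Fin n) : 0 ≤ (open Classical in
      if p i.castSucc = p i.succ then 0 else 𝒳.gen γ (p i.castSucc) (p i.succ)) := by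
    split_ifs with h
    · exact le_rfl
    · rw [𝒳.gen_of_ne h]
      exact mul_nonneg hγ.le (𝒳.L_nonneg _ _ h)
  rw [ENNReal.ofReal_mul (𝒳.m_pos _).le, ENNReal.ofReal_prod_of_nonneg fun i _ => hnn i]
  have h2 (i : Fin n) : ENNReal.ofReal (open Classical in
      if p i.castSucc = p i.succ then 0 else 𝒳.gen γ (p i.castSucc) (p i.succ)) =
      ENNReal.ofReal γ * 𝒳.jumpRate (p i.castSucc) (p i.succ) := by
    unfold jumpRate
    split_ifs with h
    · simp
    · rw [𝒳.gen_of_ne h, ENNReal.ofReal_mul hγ.le]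
  rw [Finset.prod_congr rfl fun i _ => h2 i, Finset.prod_mul_distrib, Finset.prod_const,
    Finset.card_univ, Fintype.card_fin, pathWeight]
  ring

/-- Bounds the exponential density of R^γ between e^{-γS} and 1, uniformly over paths, so that it
disappears as γ ↓ 0. -/
theorem integral_gen_mem_Icc {γ S : ℝ} (hγ : 0 < γ) (hS : ∀ x, |𝒳.L x x| ≤ S)
    (ω : unitInterval → X) : ∫ s : unitInterval, 𝒳.gen γ (ω s) (ω s) ∈ Icc (-(γ * S)) 0 := by
  simp only [gen_self]
  constructor
  · have h : ‖∫ s : unitInterval, γ * 𝒳.L (ω s) (ω s)‖ ≤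
        γ * S * (volume : Measure unitInterval).real univ := by
      refine norm_integral_le_of_norm_le_const (Eventually.of_forall fun s => ?_)
      rw [Real.norm_eq_abs, abs_mul, abs_of_pos hγ]
      exact mul_le_mul_of_nonneg_left (hS _) hγ.le
    rw [probReal_univ, mul_one, Real.norm_eq_abs] at h
    exact (abs_le.1 h).1
  · exact integral_nonpos fun s => mul_nonpos_of_nonneg_of_nonpos hγ.le (𝒳.L_diag_nonpos _)

variable [MeasurableSpace X]

/-- The coefficient of `γ ^ n` in the reference measure `R^γ`, up to the exponential density. -/
def jumpMeasure (n : ℕ) : Measure (PathSpace X) :=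
  Measure.sum fun p : Fin (n + 1) → X => (ENNReal.ofReal (𝒳.m (p 0)) * 𝒳.pathWeight p) • jumpLaw p

theorem refPath_apply {γ : ℝ} (hγ : 0 < γ) {s : Set (PathSpace X)} (hs : MeasurableSet s) :
    𝒳.refPath γ s = ∑' (n : ℕ) (p : Fin (n + 1) → X),
      ENNReal.ofReal γ ^ n * (ENNReal.ofReal (𝒳.m (p 0)) * 𝒳.pathWeight p) *
        (((volume : Measure (Fin n → ℝ)).restrict (jumpTimes n)).withDensity fun τ =>
          ENNReal.ofReal (Real.exp
            (∫ s : unitInterval, 𝒳.gen γ (stepFun τ p s) (stepFun τ p s)))).map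
              (fun τ => stepPath τ p) s := by
  rw [refPath, Measure.sum_apply _ hs]
  refine tsum_congr fun n => ?_
  rw [Measure.sum_apply _ hs]
  refine tsum_congr fun p => ?_
  rw [𝒳.ofReal_refPath_coeff hγ, Measure.smul_apply, smul_eq_mul]

variable [Countable X]

theorem jumpMeasure_apply (n : ℕ) (s : Set (PathSpace X)) :
    𝒳.jumpMeasure n s =
      ∑' p : Fin (n + 1) → X, ENNReal.ofReal (𝒳.m (p 0)) * 𝒳.pathWeight p * jumpLaw p s := by
  rw [jumpMeasure, Measure.sum_apply_of_countable]
  rfl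

theorem refPath_le {γ : ℝ} (hγ : 0 < γ) :
    𝒳.refPath γ ≤ Measure.sum fun n => ENNReal.ofReal γ ^ n • 𝒳.jumpMeasure n := by
  obtain ⟨S, hS⟩ := 𝒳.bounded
  refine Measure.le_iff.2 fun s hs => ?_
  rw [𝒳.refPath_apply hγ hs, Measure.sum_apply _ hs]
  refine ENNReal.tsum_le_tsum fun n => ?_
  rw [Measure.smul_apply, smul_eq_mul, jumpMeasure_apply, ← ENNReal.tsum_mul_left]
  refine ENNReal.tsum_le_tsum fun p => ?_
  rw [← mul_assoc (ENNReal.ofReal γ ^ n) _ (jumpLaw p s)]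
  refine mul_le_mul_right (Measure.map_mono ?_ (measurable_stepPath p) s) _
  conv_rhs => rw [← withDensity_one (μ := volume.restrict (jumpTimes n))]
  refine withDensity_mono (Eventually.of_forall fun τ => ?_)
  rw [Pi.one_apply, ENNReal.ofReal_le_one, Real.exp_le_one_iff]
  exact (𝒳.integral_gen_mem_Icc hγ hS _).2

/-- Keeping a single number n of jumps suffices as a lower bound; it will be used with n the
distance between the endpoints. -/
theorem le_refPath {γ S : ℝ} (hγ : 0 < γ) (hS : ∀ x, |𝒳.L x x| ≤ S) (n : ℕ) :
    (ENNReal.ofReal (Real.exp (-(γ * S))) * ENNReal.ofReal γ ^ n) • 𝒳.jumpMeasure n ≤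
      𝒳.refPath γ := by
  refine Measure.le_iff.2 fun s hs => ?_
  rw [𝒳.refPath_apply hγ hs]
  refine le_trans ?_ (ENNReal.le_tsum n)
  rw [Measure.smul_apply, smul_eq_mul, jumpMeasure_apply, ← ENNReal.tsum_mul_left]
  refine ENNReal.tsum_le_tsum fun p => ?_
  calc _ = ENNReal.ofReal γ ^ n * (ENNReal.ofReal (𝒳.m (p 0)) * 𝒳.pathWeight p) *
        (ENNReal.ofReal (Real.exp (-(γ * S))) • jumpLaw p) s := by
          rw [Measure.smul_apply, smul_eq_mul]; ring
    _ ≤ _ := by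
      refine mul_le_mul_right ?_ _
      rw [jumpLaw, ← Measure.map_smul]
      refine Measure.map_mono ?_ (measurable_stepPath p) s
      rw [← withDensity_const]
      refine withDensity_mono (Eventually.of_forall fun τ => ?_)
      exact ENNReal.ofReal_le_ofReal (Real.exp_le_exp.2 (𝒳.integral_gen_mem_Icc hγ hS _).1)

variable [MeasurableSingletonClass X]

theorem jumpMeasure_endpointSet (n : ℕ) (x y : X) :
    𝒳.jumpMeasure n (endpointSet x y) =
      ENNReal.ofReal (𝒳.m x) * (𝒳.walkWeight n x y * ENNReal.ofReal (1 / n.factorial)) := by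
  rw [jumpMeasure_apply, ← 𝒳.tsum_pathWeight, ← ENNReal.tsum_mul_right, ← ENNReal.tsum_mul_left]
  refine tsum_congr fun p => ?_
  rw [jumpLaw_endpointSet]
  calc _ = delta (p 0) x * ENNReal.ofReal (𝒳.m (p 0)) * (𝒳.pathWeight p *
        delta (p (Fin.last n)) y * ENNReal.ofReal (1 / n.factorial)) := by ring
    _ = delta (p 0) x * ENNReal.ofReal (𝒳.m x) * (𝒳.pathWeight p *
        delta (p (Fin.last n)) y * ENNReal.ofReal (1 / n.factorial)) := by
      rw [delta_mul_apply (p 0) x fun u => ENNReal.ofReal (𝒳.m u)]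
    _ = _ := by ring

theorem jumpMeasure_endpointSet_inter (n : ℕ) (x y z : X) (t : unitInterval) :
    𝒳.jumpMeasure n (endpointSet x y ∩ PathSpace.eval t ⁻¹' {z}) =
      ENNReal.ofReal (𝒳.m x) * ∑ k : Fin (n + 1),
        𝒳.walkWeight k x z * 𝒳.walkWeight (n - k) z y *
          ENNReal.ofReal ((n.choose k : ℝ) * (t : ℝ) ^ (k : ℕ) * (1 - t) ^ (n - k) /
            n.factorial) := by
  rw [jumpMeasure_apply]
  simp only [← 𝒳.tsum_pathWeight_through, ← ENNReal.tsum_mul_right]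
  rw [← Summable.tsum_finsetSum fun _ _ => ENNReal.summable, ← ENNReal.tsum_mul_left]
  refine tsum_congr fun p => ?_
  rw [jumpLaw_endpointSet_inter, Finset.mul_sum, Finset.mul_sum]
  refine Finset.sum_congr rfl fun k _ => ?_
  have h := delta_mul_apply (p 0) x fun u => ENNReal.ofReal (𝒳.m u)
  generalize ENNReal.ofReal ((n.choose k : ℝ) * (t : ℝ) ^ (k : ℕ) * (1 - t) ^ (n - k) /
            n.factorial) = c
  calc _ = delta (p 0) x * ENNReal.ofReal (𝒳.m (p 0)) * (𝒳.pathWeight p *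
        (delta (p k) z * delta (p (Fin.last n)) y) * c) := by ring
    _ = delta (p 0) x * ENNReal.ofReal (𝒳.m x) * (𝒳.pathWeight p *
        (delta (p k) z * delta (p (Fin.last n)) y) * c) := by rw [h]
    _ = _ := by ring

theorem jumpMeasure_endpointSet_ne_top (n : ℕ) (x y : X) :
    𝒳.jumpMeasure n (endpointSet x y) ≠ ⊤ := by
  rw [jumpMeasure_endpointSet]
  exact ENNReal.mul_ne_top ENNReal.ofReal_ne_top
    (ENNReal.mul_ne_top (𝒳.walkWeight_ne_top n x y) ENNReal.ofReal_ne_top)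

theorem jumpMeasure_dist_endpointSet_ne_zero (x y : X) :
    𝒳.jumpMeasure (𝒳.G.dist x y) (endpointSet x y) ≠ 0 := by
  rw [jumpMeasure_endpointSet]
  refine mul_ne_zero (by simpa using 𝒳.m_pos x) (mul_ne_zero (𝒳.walkWeight_dist_ne_zero x y) ?_)
  simpa using Nat.factorial_ne_zero _

/-- The factor 1/n! is discarded on purpose: a geometric bound is enough for the tail when γ is
small. -/
theorem jumpMeasure_endpointSet_le {S : ℝ} (hS : ∀ x, |𝒳.L x x| ≤ S) (n : ℕ) (x y : X) :
    𝒳.jumpMeasure n (endpointSet x y) ≤ ENNReal.ofReal (𝒳.m x) * ENNReal.ofReal S ^ n := by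
  rw [jumpMeasure_endpointSet]
  refine mul_le_mul_right ((mul_le_mul' (𝒳.walkWeight_le hS n x y) ?_).trans_eq (mul_one _)) _
  rw [ENNReal.ofReal_le_one]
  exact div_le_one_of_le₀ (by exact_mod_cast n.factorial_pos) (Nat.cast_nonneg _)

theorem jumpMeasure_start_le {S : ℝ} (hS : ∀ x, |𝒳.L x x| ≤ S) (n : ℕ) (x : X) :
    𝒳.jumpMeasure n (PathSpace.eval 0 ⁻¹' {x}) ≤
      ENNReal.ofReal (𝒳.m x) * (ENNReal.ofReal S ^ n * ENNReal.ofReal (1 / n.factorial)) := by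
  have h : PathSpace.eval 0 ⁻¹' {x} = ⋃ y : X, endpointSet x y := by
    ext ω
    simp [endpointSet]
  rw [h]
  refine (measure_iUnion_le _).trans ?_
  simp only [jumpMeasure_endpointSet, ENNReal.tsum_mul_left, ENNReal.tsum_mul_right]
  exact mul_le_mul_right (mul_le_mul_left (𝒳.tsum_walkWeight_le hS n x) _) _

/-- Here 1/n! is kept: the exponential series converges for every γ, not only for small γ. This
gives σ-finiteness of R^γ. -/
theorem refPath_start_ne_top {γ : ℝ} (hγ : 0 < γ) (x : X) :
    𝒳.refPath γ (PathSpace.eval 0 ⁻¹' {x}) ≠ ⊤ := by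
  obtain ⟨S, hS⟩ := 𝒳.bounded
  have hS0 : 0 ≤ S := (abs_nonneg _).trans (hS x)
  refine ((𝒳.refPath_le hγ _).trans_lt ?_).ne
  rw [Measure.sum_apply _ (measurable_eval 0 (measurableSet_singleton x))]
  calc ∑' n, (ENNReal.ofReal γ ^ n • 𝒳.jumpMeasure n) (PathSpace.eval 0 ⁻¹' {x})
      ≤ ∑' n : ℕ, ENNReal.ofReal (𝒳.m x) * ENNReal.ofReal ((γ * S) ^ n / n.factorial) := by
        refine ENNReal.tsum_le_tsum fun n => ?_
        rw [Measure.smul_apply, smul_eq_mul]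
        refine (mul_le_mul_right (𝒳.jumpMeasure_start_le hS n x) _).trans_eq ?_
        rw [div_eq_mul_one_div ((γ * S) ^ n), mul_pow, ENNReal.ofReal_mul (by positivity),
          ENNReal.ofReal_mul (by positivity), ENNReal.ofReal_pow hγ.le, ENNReal.ofReal_pow hS0]
        ring
    _ < ⊤ := by
        rw [ENNReal.tsum_mul_left,
          ← ENNReal.ofReal_tsum_of_nonneg (fun n => by positivity)
            (Real.summable_pow_div_factorial _)]
        exact ENNReal.mul_lt_top ENNReal.ofReal_lt_top ENNReal.ofReal_lt_top

theorem refPath_endpointSet_ne_top {γ : ℝ} (hγ : 0 < γ) (x y : X) :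
    𝒳.refPath γ (endpointSet x y) ≠ ⊤ :=
  measure_ne_top_of_subset (fun _ hω => hω.1) (𝒳.refPath_start_ne_top hγ x)

theorem refPath_endpointSet_ne_zero {γ : ℝ} (hγ : 0 < γ) (x y : X) :
    𝒳.refPath γ (endpointSet x y) ≠ 0 := by
  obtain ⟨S, hS⟩ := 𝒳.bounded
  intro h0
  have h := 𝒳.le_refPath hγ hS (𝒳.G.dist x y) (endpointSet x y)
  rw [h0, Measure.smul_apply, smul_eq_mul, nonpos_iff_eq_zero] at h
  refine absurd h (mul_ne_zero (mul_ne_zero ?_ ?_) (𝒳.jumpMeasure_dist_endpointSet_ne_zero x y))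
  · simpa using Real.exp_pos _
  · exact pow_ne_zero _ (by simpa using hγ)

theorem sigmaFinite_refPath {γ : ℝ} (hγ : 0 < γ) : SigmaFinite (𝒳.refPath γ) := by
  refine Measure.sigmaFinite_of_countable (countable_range fun x : X =>
    PathSpace.eval 0 ⁻¹' {x}) ?_ ?_
  · rintro _ ⟨x, rfl⟩
    exact (𝒳.refPath_start_ne_top hγ x).lt_top
  · ext ω
    simp

end DiscreteSpace

end ZeroTemp

/-! ### Leading-order asymptotics as the temperature tends to zero. -/

namespace ZeroTemp

/-- Terms below d vanish, the d-th is kept, and the later ones carry an extra factor g and a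
geometric series of ratio at most 1/2, whose sum is the factor 2. -/
theorem tsum_pow_mul_le_of_geometric {d : ℕ} {g σ c : ENNReal} {I : ℕ → ENNReal}
    (hlow : ∀ n < d, I n = 0) (hI : ∀ n, I n ≤ c * σ ^ n) (hgσ : g * σ ≤ 2⁻¹) :
    ∑' n, g ^ n * I n ≤ (I d + g * (c * σ ^ (d + 1) * 2)) * g ^ d := by
  have hzero : ∑ n ∈ Finset.range d, g ^ n * I n = 0 :=
    Finset.sum_eq_zero fun n hn => by rw [hlow n (Finset.mem_range.1 hn), mul_zero]
  have htail (j : ℕ) : g ^ (j + (d + 1)) * I (j + (d + 1)) ≤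
      g * (c * σ ^ (d + 1)) * g ^ d * 2⁻¹ ^ j := by
    calc _ ≤ g ^ (j + (d + 1)) * (c * σ ^ (j + (d + 1))) := mul_le_mul_right (hI _) _
      _ = g * (c * σ ^ (d + 1)) * g ^ d * (g * σ) ^ j := by
          rw [pow_add g, pow_add σ, pow_succ g d, mul_pow]
          ring
      _ ≤ _ := mul_le_mul_right (pow_le_pow_left' hgσ j) _
  rw [← Summable.sum_add_tsum_nat_add' (k := d + 1) ENNReal.summable, Finset.sum_range_succ,
    hzero, zero_add, add_mul, mul_comm (g ^ d)]
  refine add_le_add le_rfl ((ENNReal.tsum_le_tsum htail).trans_eq ?_)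
  rw [ENNReal.tsum_mul_left, ENNReal.tsum_geometric, ENNReal.one_sub_inv_two, inv_inv]
  ring

/-- Shifting by the bound M makes F nonnegative, which transfers the limits of lower integrals to
real-valued functions. -/
theorem integral_eq_toReal_lintegral_sub {Ω : Type*} [MeasurableSpace Ω] (μ : Measure Ω)
    [IsProbabilityMeasure μ] {F : Ω → ℝ} (hF : Measurable F) {M : ℝ} (hM : ∀ ω, |F ω| ≤ M) :
    ∫ ω, F ω ∂μ = (∫⁻ ω, ENNReal.ofReal (F ω + M) ∂μ).toReal - M := by
  have hint : Integrable F μ := Integrable.of_bound hF.aestronglyMeasurable M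
    (Eventually.of_forall hM)
  rw [← integral_eq_lintegral_of_nonneg_ae
    (Eventually.of_forall fun ω => by have := (abs_le.1 (hM ω)).1; simp; linarith)
    (hF.add_const M).aestronglyMeasurable, integral_add hint (integrable_const M)]
  simp

variable {X : Type*} [MeasurableSpace X] [Countable X]

namespace DiscreteSpace

variable (𝒳 : DiscreteSpace X)

/-! ### Zero-temperature limit of the bridges -/

theorem mul_le_setLIntegral_refPath_div {γ S : ℝ} (hγ : 0 < γ) (hS : ∀ x, |𝒳.L x x| ≤ S)
    (x y : X) (F : PathSpace X → ENNReal) :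
    ENNReal.ofReal (Real.exp (-(γ * S))) *
        (∫⁻ ω in endpointSet x y, F ω ∂𝒳.jumpMeasure (𝒳.G.dist x y)) ≤
      (∫⁻ ω in endpointSet x y, F ω ∂𝒳.refPath γ) / ENNReal.ofReal γ ^ 𝒳.G.dist x y := by
  have hg0 : ENNReal.ofReal γ ^ 𝒳.G.dist x y ≠ 0 := pow_ne_zero _ (by simpa using hγ)
  have hgt : ENNReal.ofReal γ ^ 𝒳.G.dist x y ≠ ⊤ := ENNReal.pow_ne_top ENNReal.ofReal_ne_top
  rw [ENNReal.le_div_iff_mul_le (Or.inl hg0) (Or.inl hgt)]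
  refine le_trans (le_of_eq ?_) (lintegral_mono'
    (Measure.restrict_mono subset_rfl (𝒳.le_refPath hγ hS (𝒳.G.dist x y))) le_rfl)
  rw [Measure.restrict_smul, lintegral_smul_measure, smul_eq_mul]
  ring

variable [MeasurableSingletonClass X]

theorem setLIntegral_refPath_le {γ : ℝ} (hγ : 0 < γ) (x y : X) (F : PathSpace X → ENNReal) :
    ∫⁻ ω in endpointSet x y, F ω ∂𝒳.refPath γ ≤
      ∑' n, ENNReal.ofReal γ ^ n * ∫⁻ ω in endpointSet x y, F ω ∂𝒳.jumpMeasure n := by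
  refine (lintegral_mono' (Measure.restrict_mono subset_rfl (𝒳.refPath_le hγ)) le_rfl).trans_eq ?_
  rw [Measure.restrict_sum _ (measurableSet_endpointSet x y), lintegral_sum_measure]
  refine tsum_congr fun n => ?_
  rw [Measure.restrict_smul, lintegral_smul_measure, smul_eq_mul]

theorem setLIntegral_refPath_div_le {γ S : ℝ} (hγ : 0 < γ) (hS : ∀ x, |𝒳.L x x| ≤ S)
    (hγS : ENNReal.ofReal γ * ENNReal.ofReal S ≤ 2⁻¹) (x y : X) {F : PathSpace X → ENNReal}
    {M : ENNReal} (hM : ∀ ω, F ω ≤ M) :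
    (∫⁻ ω in endpointSet x y, F ω ∂𝒳.refPath γ) / ENNReal.ofReal γ ^ 𝒳.G.dist x y ≤
      (∫⁻ ω in endpointSet x y, F ω ∂𝒳.jumpMeasure (𝒳.G.dist x y)) +
        ENNReal.ofReal γ * (M * ENNReal.ofReal (𝒳.m x) *
          ENNReal.ofReal S ^ (𝒳.G.dist x y + 1) * 2) := by
  have hI (n : ℕ) : ∫⁻ ω in endpointSet x y, F ω ∂𝒳.jumpMeasure n ≤
      M * 𝒳.jumpMeasure n (endpointSet x y) := by
    refine (lintegral_mono fun ω => hM ω).trans_eq ?_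
    rw [lintegral_const, Measure.restrict_apply_univ]
  have hlow (n : ℕ) (hn : n < 𝒳.G.dist x y) :
      ∫⁻ ω in endpointSet x y, F ω ∂𝒳.jumpMeasure n = 0 := by
    refine le_antisymm ((hI n).trans_eq ?_) zero_le
    rw [jumpMeasure_endpointSet, 𝒳.walkWeight_eq_zero hn, zero_mul, mul_zero, mul_zero]
  have hg0 : ENNReal.ofReal γ ^ 𝒳.G.dist x y ≠ 0 := pow_ne_zero _ (by simpa using hγ)
  have hgt : ENNReal.ofReal γ ^ 𝒳.G.dist x y ≠ ⊤ := ENNReal.pow_ne_top ENNReal.ofReal_ne_top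
  rw [ENNReal.div_le_iff hg0 hgt]
  refine (𝒳.setLIntegral_refPath_le hγ x y F).trans
    (tsum_pow_mul_le_of_geometric hlow (fun n => (hI n).trans ?_) hγS)
  rw [mul_assoc]
  exact mul_le_mul_right (𝒳.jumpMeasure_endpointSet_le hS n x y) _

/-- Squeeze between e^{-γS} times the leading coefficient and that coefficient plus O(γ). Only
boundedness of F enters, so the limit holds well beyond continuous functions. -/
theorem tendsto_setLIntegral_refPath_div (x y : X) {F : PathSpace X → ENNReal} {M : ENNReal}
    (hMtop : M ≠ ⊤) (hM : ∀ ω, F ω ≤ M) :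
    Tendsto (fun γ : ℝ => (∫⁻ ω in endpointSet x y, F ω ∂𝒳.refPath γ) /
        ENNReal.ofReal γ ^ 𝒳.G.dist x y) (𝓝[>] 0)
      (𝓝 (∫⁻ ω in endpointSet x y, F ω ∂𝒳.jumpMeasure (𝒳.G.dist x y))) := by
  obtain ⟨S, hS⟩ := 𝒳.bounded
  set I := ∫⁻ ω in endpointSet x y, F ω ∂𝒳.jumpMeasure (𝒳.G.dist x y) with hI
  set c := M * ENNReal.ofReal (𝒳.m x) * ENNReal.ofReal S ^ (𝒳.G.dist x y + 1) * 2 with hc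
  have hctop : c ≠ ⊤ := by
    refine ENNReal.mul_ne_top (ENNReal.mul_ne_top (ENNReal.mul_ne_top hMtop ENNReal.ofReal_ne_top)
      (ENNReal.pow_ne_top ENNReal.ofReal_ne_top)) (by simp)
  have hγ0 : Tendsto (fun γ : ℝ => ENNReal.ofReal γ) (𝓝[>] 0) (𝓝 0) := by
    have := (ENNReal.continuous_ofReal.tendsto 0).mono_left (nhdsWithin_le_nhds (s := Ioi (0 : ℝ)))
    simpa using this
  have hlow : Tendsto (fun γ : ℝ => ENNReal.ofReal (Real.exp (-(γ * S))) * I) (𝓝[>] 0) (𝓝 I) := by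
    have h1 : Continuous fun γ : ℝ => ENNReal.ofReal (Real.exp (-(γ * S))) :=
      ENNReal.continuous_ofReal.comp (by fun_prop)
    have h2 := (h1.tendsto 0).mono_left (nhdsWithin_le_nhds (s := Ioi (0 : ℝ)))
    have h3 := ENNReal.Tendsto.mul_const (b := I) h2 (Or.inl (by simp))
    simpa using h3
  have hup : Tendsto (fun γ : ℝ => I + ENNReal.ofReal γ * c) (𝓝[>] 0) (𝓝 I) := by
    have := tendsto_const_nhds (x := I) |>.add (ENNReal.Tendsto.mul_const hγ0 (Or.inr hctop))
    simpa using this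
  refine tendsto_of_tendsto_of_tendsto_of_le_of_le' hlow hup ?_ ?_
  · filter_upwards [self_mem_nhdsWithin] with γ hγ
    exact 𝒳.mul_le_setLIntegral_refPath_div hγ hS x y F
  · have hsmall : Tendsto (fun γ : ℝ => ENNReal.ofReal γ * ENNReal.ofReal S) (𝓝[>] 0) (𝓝 0) := by
      simpa using ENNReal.Tendsto.mul_const hγ0 (Or.inr (ENNReal.ofReal_ne_top (r := S)))
    filter_upwards [self_mem_nhdsWithin, hsmall.eventually_le_const (u := 2⁻¹) (by simp)]
      with γ hγ h2
    exact 𝒳.setLIntegral_refPath_div_le hγ hS h2 x y hM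

theorem tendsto_refPath_endpointSet_div (x y : X) :
    Tendsto (fun γ : ℝ => 𝒳.refPath γ (endpointSet x y) / ENNReal.ofReal γ ^ 𝒳.G.dist x y) (𝓝[>] 0)
      (𝓝 (𝒳.jumpMeasure (𝒳.G.dist x y) (endpointSet x y))) := by
  have := 𝒳.tendsto_setLIntegral_refPath_div x y (F := fun _ => 1) ENNReal.one_ne_top
    fun _ => le_rfl
  simpa using this

/-- The bridge of the process at temperature `γ`. -/
def bridgeLaw (γ : ℝ) (x y : X) : Measure (PathSpace X) :=
  ProbabilityTheory.cond (𝒳.refPath γ) (endpointSet x y)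

/-- The law of the bridge at zero temperature on path space. -/
def zeroBridgeLaw (x y : X) : Measure (PathSpace X) :=
  ProbabilityTheory.cond (𝒳.jumpMeasure (𝒳.G.dist x y)) (endpointSet x y)

theorem isProbabilityMeasure_bridgeLaw {γ : ℝ} (hγ : 0 < γ) (x y : X) :
    IsProbabilityMeasure (𝒳.bridgeLaw γ x y) :=
  ProbabilityTheory.cond_isProbabilityMeasure_of_finite (𝒳.refPath_endpointSet_ne_zero hγ x y)
    (𝒳.refPath_endpointSet_ne_top hγ x y)

theorem isProbabilityMeasure_zeroBridgeLaw (x y : X) :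
    IsProbabilityMeasure (𝒳.zeroBridgeLaw x y) :=
  ProbabilityTheory.cond_isProbabilityMeasure_of_finite (𝒳.jumpMeasure_dist_endpointSet_ne_zero x y)
    (𝒳.jumpMeasure_endpointSet_ne_top _ x y)

theorem tendsto_lintegral_bridgeLaw (x y : X) {F : PathSpace X → ENNReal} {M : ENNReal}
    (hMtop : M ≠ ⊤) (hM : ∀ ω, F ω ≤ M) :
    Tendsto (fun γ : ℝ => ∫⁻ ω, F ω ∂𝒳.bridgeLaw γ x y) (𝓝[>] 0)
      (𝓝 (∫⁻ ω, F ω ∂𝒳.zeroBridgeLaw x y)) := by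
  have h1 := 𝒳.tendsto_setLIntegral_refPath_div x y hMtop hM
  have h2 := 𝒳.tendsto_refPath_endpointSet_div x y
  have h0 := 𝒳.jumpMeasure_dist_endpointSet_ne_zero x y
  have ht := 𝒳.jumpMeasure_endpointSet_ne_top (𝒳.G.dist x y) x y
  have hfin : ∫⁻ ω in endpointSet x y, F ω ∂𝒳.jumpMeasure (𝒳.G.dist x y) ≠ ⊤ := by
    refine ((lintegral_mono fun ω => hM ω).trans_lt ?_).ne
    rw [lintegral_const, Measure.restrict_apply_univ]
    exact ENNReal.mul_lt_top hMtop.lt_top ht.lt_top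
  -- A conditional integral is a quotient of two masses of the same order γ^{d(x,y)}; the powers
  -- cancel and the leading coefficients remain.
  have h3 := ENNReal.Tendsto.mul (tendsto_inv_iff.2 h2) (Or.inr hfin) h1
    (Or.inr (ENNReal.inv_ne_top.2 h0))
  simp only [bridgeLaw, zeroBridgeLaw, ProbabilityTheory.cond, lintegral_smul_measure, smul_eq_mul]
  refine h3.congr' ?_
  filter_upwards [self_mem_nhdsWithin] with γ hγ
  have hg0 : ENNReal.ofReal γ ^ 𝒳.G.dist x y ≠ 0 := pow_ne_zero _ (by simpa using hγ)
  have hgt : ENNReal.ofReal γ ^ 𝒳.G.dist x y ≠ ⊤ := ENNReal.pow_ne_top ENNReal.ofReal_ne_top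
  rw [ENNReal.inv_div (Or.inl hgt) (Or.inl hg0), div_eq_mul_inv, div_eq_mul_inv]
  calc _ = (ENNReal.ofReal γ ^ 𝒳.G.dist x y * (ENNReal.ofReal γ ^ 𝒳.G.dist x y)⁻¹) *
        ((𝒳.refPath γ (endpointSet x y))⁻¹ * ∫⁻ ω in endpointSet x y, F ω ∂𝒳.refPath γ) := by ring
    _ = _ := by rw [ENNReal.mul_inv_cancel hg0 hgt, one_mul]

theorem tendsto_integral_bridgeLaw (x y : X) {F : PathSpace X → ℝ} (hF : Measurable F) {M : ℝ}
    (hM : ∀ ω, |F ω| ≤ M) :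
    Tendsto (fun γ : ℝ => ∫ ω, F ω ∂𝒳.bridgeLaw γ x y) (𝓝[>] 0)
      (𝓝 (∫ ω, F ω ∂𝒳.zeroBridgeLaw x y)) := by
  have := 𝒳.isProbabilityMeasure_zeroBridgeLaw x y
  have hle (ω : PathSpace X) : ENNReal.ofReal (F ω + M) ≤ ENNReal.ofReal (M + M) :=
    ENNReal.ofReal_le_ofReal (by linarith [(abs_le.1 (hM ω)).2])
  rw [integral_eq_toReal_lintegral_sub _ hF hM]
  have hfin : ∫⁻ ω, ENNReal.ofReal (F ω + M) ∂𝒳.zeroBridgeLaw x y ≠ ⊤ := by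
    refine ((lintegral_mono hle).trans_lt ?_).ne
    simp
  have h := (ENNReal.tendsto_toReal hfin).comp
    (𝒳.tendsto_lintegral_bridgeLaw x y ENNReal.ofReal_ne_top hle)
  refine (h.sub_const M).congr' ?_
  filter_upwards [self_mem_nhdsWithin] with γ hγ
  have := 𝒳.isProbabilityMeasure_bridgeLaw hγ x y
  rw [integral_eq_toReal_lintegral_sub _ hF hM]
  rfl

theorem zeroBridgeLaw_eval (t : unitInterval) (x y z : X) :
    𝒳.zeroBridgeLaw x y (PathSpace.eval t ⁻¹' {z}) =
      ENNReal.ofReal (𝒳.bridgeMass t x y z) := by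
  have h0 := 𝒳.jumpMeasure_dist_endpointSet_ne_zero x y
  have ht := 𝒳.jumpMeasure_endpointSet_ne_top (𝒳.G.dist x y) x y
  rw [zeroBridgeLaw, ProbabilityTheory.cond_apply (measurableSet_endpointSet x y),
    𝒳.jumpMeasure_endpointSet_inter, 𝒳.sum_walkWeight_mul_eq_bridgeMass,
    ← mul_assoc (ENNReal.ofReal (𝒳.m x)),
    ← jumpMeasure_endpointSet, ← mul_assoc, ENNReal.inv_mul_cancel h0 ht, one_mul]

end DiscreteSpace

end ZeroTemp

namespace ZeroTemp

/-! ### Existence of the limit Schrödinger problem optimizer -/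

theorem ae_mem_of_measure_eq_one {Y : Type*} [MeasurableSpace Y] {ν : Measure Y}
    [IsProbabilityMeasure ν] {s : Set Y} (hs : MeasurableSet s) (h : ν s = 1) :
    ∀ᵐ y ∂ν, y ∈ s :=
  (prob_compl_eq_zero_iff hs).2 h

variable {X : Type*}

/-- The paths from `i.1` to `i.2`. -/
def finEndpointSet (K : Finset X) (i : K × K) : Set (PathSpace X) := endpointSet (i.1 : X) i.2

theorem pairwise_disjoint_finEndpointSet {K : Finset X} :
    Pairwise (Function.onFun Disjoint (finEndpointSet K)) := by
  intro i j hij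
  refine disjoint_endpointSet fun h => hij ?_
  rw [Prod.mk.injEq] at h
  exact Prod.ext (Subtype.ext h.1) (Subtype.ext h.2)

variable [MeasurableSpace X] [MeasurableSingletonClass X]

theorem measurableSet_finEndpointSet {K : Finset X} (i : K × K) :
    MeasurableSet (finEndpointSet K i) :=
  measurableSet_endpointSet _ _

theorem cond_endpointSet_start {M : Measure (PathSpace X)} {x y : X} (h0 : M (endpointSet x y) ≠ 0)
    (ht : M (endpointSet x y) ≠ ⊤) (z : X) :
    ProbabilityTheory.cond M (endpointSet x y) (PathSpace.eval 0 ⁻¹' {z}) = delta x z := by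
  rw [ProbabilityTheory.cond_apply (measurableSet_endpointSet x y)]
  by_cases h : x = z
  · have : endpointSet x y ∩ PathSpace.eval 0 ⁻¹' {z} = endpointSet x y :=
      inter_eq_left.2 fun ω hω => hω.1.trans h
    rw [this, h, delta_self, ← h, ENNReal.inv_mul_cancel h0 ht]
  · have : endpointSet x y ∩ PathSpace.eval 0 ⁻¹' {z} = ∅ := by
      rw [eq_empty_iff_forall_notMem]
      rintro ω ⟨h1, h2⟩
      exact h (h1.1.symm.trans h2)
    rw [this, delta_of_ne h, measure_empty, mul_zero]

theorem cond_endpointSet_end {M : Measure (PathSpace X)} {x y : X} (h0 : M (endpointSet x y) ≠ 0)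
    (ht : M (endpointSet x y) ≠ ⊤) (z : X) :
    ProbabilityTheory.cond M (endpointSet x y) (PathSpace.eval 1 ⁻¹' {z}) = delta y z := by
  rw [ProbabilityTheory.cond_apply (measurableSet_endpointSet x y)]
  by_cases h : y = z
  · have : endpointSet x y ∩ PathSpace.eval 1 ⁻¹' {z} = endpointSet x y :=
      inter_eq_left.2 fun ω hω => hω.2.trans h
    rw [this, h, delta_self, ← h, ENNReal.inv_mul_cancel h0 ht]
  · have : endpointSet x y ∩ PathSpace.eval 1 ⁻¹' {z} = ∅ := by
      rw [eq_empty_iff_forall_notMem]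
      rintro ω ⟨h1, h2⟩
      exact h (h1.2.symm.trans h2)
    rw [this, delta_of_ne h, measure_empty, mul_zero]

theorem ae_eval_mem {K : Finset X} {Q : ProbabilityMeasure (PathSpace X)} {ν : ProbabilityMeasure X}
    {t : unitInterval} (hν : (ν : Measure X) (K : Set X) = 1)
    (hQ : marginal (Q : Measure (PathSpace X)) t = ν) :
    ∀ᵐ ω ∂(Q : Measure (PathSpace X)), ω.eval t ∈ K := by
  have := ae_mem_of_measure_eq_one K.measurableSet hν
  rw [← hQ] at this
  exact ae_of_ae_map (measurable_eval t).aemeasurable this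

/-- A probability measure carried by a finite set is determined by its point masses. -/
theorem measure_singleton_eq_sum (K : Finset X) (ν : ProbabilityMeasure X)
    (hν : (ν : Measure X) (K : Set X) = 1) (z : X) :
    (ν : Measure X) {z} =
      ∑ x : K, ENNReal.ofReal ((ν : Measure X).real {(x : X)}) * delta (x : X) z := by
  have e (x : X) : ENNReal.ofReal ((ν : Measure X).real {x}) = (ν : Measure X) {x} :=
    ENNReal.ofReal_toReal (measure_ne_top _ _)
  simp only [e]
  by_cases hz : z ∈ K
  · rw [Finset.sum_eq_single ⟨z, hz⟩]
    · simp
    · intro x _ hx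
      rw [delta_of_ne fun h => hx (Subtype.ext h), mul_zero]
    · simp
  · rw [Finset.sum_eq_zero]
    · have := ae_mem_of_measure_eq_one K.measurableSet hν
      refine measure_mono_null ?_ (ae_iff.1 this)
      rintro _ rfl
      exact hz
    · intro x _
      rw [delta_of_ne fun h : (x : X) = z => hz (h ▸ x.2), mul_zero]

theorem sum_subtype_measureReal (K : Finset X) (ν : ProbabilityMeasure X)
    (hν : (ν : Measure X) (K : Set X) = 1) : ∑ x : K, (ν : Measure X).real {(x : X)} = 1 := by
  rw [Finset.sum_coe_sort K fun x => (ν : Measure X).real {x},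
    MeasureTheory.sum_measureReal_singleton, measureReal_def, hν,
    ENNReal.toReal_one]

/-! ### Endpoint laws and couplings on a finite set. -/

section Coupling

variable {K : Finset X} {ν₀ ν₁ : ProbabilityMeasure X}

/-- Couplings of two probability measures carried by the finite set `K`. -/
def measureCouplings (K : Finset X) (ν₀ ν₁ : ProbabilityMeasure X) : Set (K × K → ℝ) :=
  couplings (fun x : K => (ν₀ : Measure X).real {(x : X)})
    fun x : K => (ν₁ : Measure X).real {(x : X)}

theorem ae_mem_iUnion_finEndpointSet {Q : ProbabilityMeasure (PathSpace X)}
    (h0 : (ν₀ : Measure X) (K : Set X) = 1) (h1 : (ν₁ : Measure X) (K : Set X) = 1)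
    (hQ0 : marginal (Q : Measure (PathSpace X)) 0 = ν₀)
    (hQ1 : marginal (Q : Measure (PathSpace X)) 1 = ν₁) :
    ∀ᵐ ω ∂(Q : Measure (PathSpace X)), ω ∈ ⋃ i, finEndpointSet K i := by
  filter_upwards [ae_eval_mem h0 hQ0, ae_eval_mem h1 hQ1] with ω ha hb
  exact mem_iUnion.2 ⟨(⟨_, ha⟩, ⟨_, hb⟩), rfl, rfl⟩

/-- Makes every competitor in the dynamic problem a competitor in the static one: paths almost
surely start and end in K, so summing over one endpoint in K recovers the marginal. -/
theorem measureReal_finEndpointSet_mem_couplings {Q : ProbabilityMeasure (PathSpace X)}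
    (h0 : (ν₀ : Measure X) (K : Set X) = 1) (h1 : (ν₁ : Measure X) (K : Set X) = 1)
    (hQ0 : marginal (Q : Measure (PathSpace X)) 0 = ν₀)
    (hQ1 : marginal (Q : Measure (PathSpace X)) 1 = ν₁) :
    (fun i => (Q : Measure (PathSpace X)).real (finEndpointSet K i)) ∈
      measureCouplings K ν₀ ν₁ := by
  refine ⟨fun i => measureReal_nonneg, fun x => ?_, fun y => ?_⟩
  · dsimp only
    have hd : Pairwise (Function.onFun Disjoint fun y : K => finEndpointSet K (x, y)) :=
      fun y y' hy => pairwise_disjoint_finEndpointSet fun h => hy (Prod.ext_iff.1 h).2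
    rw [← measureReal_iUnion_fintype hd fun y => measurableSet_finEndpointSet (x, y), ← hQ0,
      marginal, map_measureReal_apply (measurable_eval 0) (measurableSet_singleton _)]
    refine measureReal_congr ?_
    filter_upwards [ae_eval_mem h1 hQ1] with ω hω
    refine propext ⟨fun h => ?_, fun h => ?_⟩
    · obtain ⟨y, hy⟩ := mem_iUnion.1 h
      exact hy.1
    · exact mem_iUnion.2 ⟨⟨_, hω⟩, h, rfl⟩
  · dsimp only
    have hd : Pairwise (Function.onFun Disjoint fun x : K => finEndpointSet K (x, y)) :=
      fun x x' hx => pairwise_disjoint_finEndpointSet fun h => hx (Prod.ext_iff.1 h).1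
    rw [← measureReal_iUnion_fintype hd fun x => measurableSet_finEndpointSet (x, y), ← hQ1,
      marginal, map_measureReal_apply (measurable_eval 1) (measurableSet_singleton _)]
    refine measureReal_congr ?_
    filter_upwards [ae_eval_mem h0 hQ0] with ω hω
    refine propext ⟨fun h => ?_, fun h => ?_⟩
    · obtain ⟨y, hy⟩ := mem_iUnion.1 h
      exact hy.2
    · exact mem_iUnion.2 ⟨⟨_, hω⟩, rfl, h⟩

variable [Countable X]

theorem marginal_zero_mixture (h0 : (ν₀ : Measure X) (K : Set X) = 1) {π : K × K → ℝ}
    (hπ : π ∈ measureCouplings K ν₀ ν₁) {M : K × K → Measure (PathSpace X)}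
    (hM0 : ∀ i, M i (finEndpointSet K i) ≠ 0) (hM : ∀ i, M i (finEndpointSet K i) ≠ ⊤) :
    marginal (mixture π M (finEndpointSet K)) 0 = ν₀ := by
  refine Measure.ext_of_singleton fun z => ?_
  rw [marginal, Measure.map_apply (measurable_eval 0) (measurableSet_singleton z), mixture_apply,
    measure_singleton_eq_sum K ν₀ h0, Fintype.sum_prod_type]
  refine Finset.sum_congr rfl fun x _ => ?_
  have hx : ∑ y, π (x, y) = (ν₀ : Measure X).real {(x : X)} := hπ.2.1 x
  rw [← hx, ENNReal.ofReal_sum_of_nonneg fun y _ => hπ.1 (x, y), Finset.sum_mul]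
  refine Finset.sum_congr rfl fun y _ => ?_
  rw [finEndpointSet, cond_endpointSet_start (hM0 (x, y)) (hM (x, y))]

theorem marginal_one_mixture (h1 : (ν₁ : Measure X) (K : Set X) = 1) {π : K × K → ℝ}
    (hπ : π ∈ measureCouplings K ν₀ ν₁) {M : K × K → Measure (PathSpace X)}
    (hM0 : ∀ i, M i (finEndpointSet K i) ≠ 0) (hM : ∀ i, M i (finEndpointSet K i) ≠ ⊤) :
    marginal (mixture π M (finEndpointSet K)) 1 = ν₁ := by
  refine Measure.ext_of_singleton fun z => ?_
  rw [marginal, Measure.map_apply (measurable_eval 1) (measurableSet_singleton z), mixture_apply,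
    measure_singleton_eq_sum K ν₁ h1, Fintype.sum_prod_type_right]
  refine Finset.sum_congr rfl fun y _ => ?_
  have hy : ∑ x, π (x, y) = (ν₁ : Measure X).real {(y : X)} := hπ.2.2 y
  rw [← hy, ENNReal.ofReal_sum_of_nonneg fun x _ => hπ.1 (x, y), Finset.sum_mul]
  refine Finset.sum_congr rfl fun x _ => ?_
  rw [finEndpointSet, cond_endpointSet_end (hM0 (x, y)) (hM (x, y))]

end Coupling

namespace DiscreteSpace

variable [Countable X] (𝒳 : DiscreteSpace X) {K : Finset X} {ν₀ ν₁ : ProbabilityMeasure X}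

/-- Mixtures of bridges whose endpoint law minimizes the static entropy are Schrödinger
optimizers. -/
theorem isSchrodingerOptimizer_mixture {γ : ℝ} (hγ : 0 < γ)
    (h0 : (ν₀ : Measure X) (K : Set X) = 1) (h1 : (ν₁ : Measure X) (K : Set X) = 1)
    {p : K × K → ℝ} (hp : p ∈ measureCouplings K ν₀ ν₁)
    (hmin : ∀ q ∈ measureCouplings K ν₀ ν₁,
      discreteEntropy (fun i => (𝒳.refPath γ).real (finEndpointSet K i)) p ≤
        discreteEntropy (fun i => (𝒳.refPath γ).real (finEndpointSet K i)) q)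
    (Q : ProbabilityMeasure (PathSpace X))
    (hQ : (Q : Measure (PathSpace X)) = mixture p (fun _ => 𝒳.refPath γ) (finEndpointSet K)) :
    𝒳.IsSchrodingerOptimizer γ ν₀ ν₁ Q := by
  have hR0 (i : K × K) : 𝒳.refPath γ (finEndpointSet K i) ≠ 0 :=
    𝒳.refPath_endpointSet_ne_zero hγ _ _
  have hR (i : K × K) : 𝒳.refPath γ (finEndpointSet K i) ≠ ⊤ :=
    𝒳.refPath_endpointSet_ne_top hγ _ _
  have := 𝒳.sigmaFinite_refPath hγ
  refine ⟨⟨?_, ?_⟩, fun Q' hQ0 hQ1 => ?_⟩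
  · rw [hQ]
    exact marginal_zero_mixture h0 hp hR0 hR
  · rw [hQ]
    exact marginal_one_mixture h1 hp hR0 hR
  · rw [hQ, relEntropy_mixture (𝒳.refPath γ) (finEndpointSet K) measurableSet_finEndpointSet
      pairwise_disjoint_finEndpointSet hR0 hR hp.1
      (sum_eq_one_of_mem_couplings (sum_subtype_measureReal K ν₀ h0) hp)]
    -- Any competitor has entropy at least that of its endpoint weights, which form a coupling and
    -- are therefore no better than p.
    refine le_trans ?_ (discreteEntropy_le_relEntropy (Q' : Measure (PathSpace X)) (𝒳.refPath γ)
      (finEndpointSet K) measurableSet_finEndpointSet pairwise_disjoint_finEndpointSet hR0 hR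
      (ae_mem_iUnion_finEndpointSet h0 h1 hQ0 hQ1))
    rw [EReal.coe_le_coe_iff]
    exact hmin _ (measureReal_finEndpointSet_mem_couplings h0 h1 hQ0 hQ1)

/-- The mixture of zero-temperature bridges with weights `π` on the endpoints. -/
def zeroMixture (K : Finset X) (π : K × K → ℝ) : Measure (PathSpace X) :=
  mixture π (fun i => 𝒳.jumpMeasure (𝒳.G.dist (i.1 : X) i.2)) (finEndpointSet K)

theorem isProbabilityMeasure_zeroMixture {π : K × K → ℝ} (hπ : ∀ i, 0 ≤ π i)
    (hsum : ∑ i, π i = 1) : IsProbabilityMeasure (𝒳.zeroMixture K π) :=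
  isProbabilityMeasure_mixture (fun _ => 𝒳.jumpMeasure_dist_endpointSet_ne_zero _ _)
    (fun _ => 𝒳.jumpMeasure_endpointSet_ne_top _ _ _) hπ hsum

/-- For marginals carried by a finite set the limit Schrödinger problem has an optimizer, which is a
mixture of zero-temperature bridges. -/
theorem exists_isLimitOptimizer (h0 : (ν₀ : Measure X) (K : Set X) = 1)
    (h1 : (ν₁ : Measure X) (K : Set X) = 1) :
    ∃ π ∈ measureCouplings K ν₀ ν₁, ∃ Q₀ : ProbabilityMeasure (PathSpace X),
      (Q₀ : Measure (PathSpace X)) = 𝒳.zeroMixture K π ∧ 𝒳.IsLimitOptimizer ν₀ ν₁ Q₀ := by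
  have hsum {π : K × K → ℝ} (hπ : π ∈ measureCouplings K ν₀ ν₁) : ∑ i, π i = 1 :=
    sum_eq_one_of_mem_couplings (sum_subtype_measureReal K ν₀ h0) hπ
  have hR0 {γ : ℝ} (hγ : 0 < γ) (i : K × K) : 𝒳.refPath γ (finEndpointSet K i) ≠ 0 :=
    𝒳.refPath_endpointSet_ne_zero hγ _ _
  have hR {γ : ℝ} (hγ : 0 < γ) (i : K × K) : 𝒳.refPath γ (finEndpointSet K i) ≠ ⊤ :=
    𝒳.refPath_endpointSet_ne_top hγ _ _
  have hJ0 (i : K × K) : 𝒳.jumpMeasure (𝒳.G.dist (i.1 : X) i.2) (finEndpointSet K i) ≠ 0 :=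
    𝒳.jumpMeasure_dist_endpointSet_ne_zero _ _
  have hJ (i : K × K) : 𝒳.jumpMeasure (𝒳.G.dist (i.1 : X) i.2) (finEndpointSet K i) ≠ ⊤ :=
    𝒳.jumpMeasure_endpointSet_ne_top _ _ _
  have hlim (i : K × K) : Tendsto (fun γ : ℝ => (𝒳.refPath γ).real (finEndpointSet K i) /
      γ ^ 𝒳.G.dist (i.1 : X) i.2) (𝓝[>] 0)
      (𝓝 ((𝒳.jumpMeasure (𝒳.G.dist (i.1 : X) i.2)).real (finEndpointSet K i))) := by
    refine ((ENNReal.tendsto_toReal (hJ i)).comp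
      (𝒳.tendsto_refPath_endpointSet_div (i.1 : X) i.2)).congr' ?_
    filter_upwards [self_mem_nhdsWithin] with γ hγ
    rw [Function.comp_apply, ENNReal.toReal_div, ENNReal.toReal_pow, ENNReal.toReal_ofReal
      (le_of_lt hγ)]
    rfl
  obtain ⟨p, p₀, hp, hp₀, hmin, htend⟩ := exists_tendsto_minimizers
    (isCompact_couplings _ _) (couplings_nonempty (fun _ => measureReal_nonneg)
      (fun _ => measureReal_nonneg) (sum_subtype_measureReal K ν₀ h0)
      (sum_subtype_measureReal K ν₁ h1)) (convex_couplings _ _) (fun _ h => h.1)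
    (fun γ i => (𝒳.refPath γ).real (finEndpointSet K i)) _ (fun i => 𝒳.G.dist (i.1 : X) i.2)
    (fun γ hγ i => ENNReal.toReal_pos (hR0 hγ i) (hR hγ i))
    (fun i => ENNReal.toReal_pos (hJ0 i) (hJ i)) hlim
  set Q₀ : ProbabilityMeasure (PathSpace X) :=
    ⟨𝒳.zeroMixture K p₀, 𝒳.isProbabilityMeasure_zeroMixture hp₀.1 (hsum hp₀)⟩ with hQ₀
  classical
  -- The value for γ ≤ 0 is a filler; both optimality and the limit concern γ > 0 only.
  set Q : ℝ → ProbabilityMeasure (PathSpace X) := fun γ =>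
    if hγ : 0 < γ then ⟨mixture (p γ) (fun _ => 𝒳.refPath γ) (finEndpointSet K),
      isProbabilityMeasure_mixture (hR0 hγ) (hR hγ) (hp γ).1 (hsum (hp γ))⟩ else Q₀ with hQdef
  have hQ {γ : ℝ} (hγ : 0 < γ) : (Q γ : Measure (PathSpace X)) =
      mixture (p γ) (fun _ => 𝒳.refPath γ) (finEndpointSet K) := by
    simp [hQdef, hγ]
  refine ⟨p₀, hp₀, Q₀, rfl, Q, fun γ hγ =>
    𝒳.isSchrodingerOptimizer_mixture hγ h0 h1 (hp γ) (hmin γ) (Q γ) (hQ hγ), ?_⟩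
  -- The integral of F is a finite sum of weights times bridge integrals, and each of the two
  -- factors converges.
  rintro F - hFm ⟨M, hM⟩
  have hint (μ : Measure (PathSpace X)) [IsProbabilityMeasure μ] : Integrable F μ :=
    Integrable.of_bound hFm.aestronglyMeasurable M (Eventually.of_forall hM)
  have hlimit : ∫ ω, F ω ∂(Q₀ : Measure (PathSpace X)) =
      ∑ i : K × K, p₀ i * ∫ ω, F ω ∂𝒳.zeroBridgeLaw (i.1 : X) i.2 :=
    integral_mixture hp₀.1 fun i =>
      have := 𝒳.isProbabilityMeasure_zeroBridgeLaw (i.1 : X) i.2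
      hint (𝒳.zeroBridgeLaw (i.1 : X) i.2)
  rw [hlimit]
  have hsumlim : Tendsto (fun γ : ℝ =>
      ∑ i : K × K, p γ i * ∫ ω, F ω ∂𝒳.bridgeLaw γ (i.1 : X) i.2) (𝓝[>] 0)
      (𝓝 (∑ i : K × K, p₀ i * ∫ ω, F ω ∂𝒳.zeroBridgeLaw (i.1 : X) i.2)) :=
    tendsto_finsetSum _ fun i _ =>
      (tendsto_pi_nhds.1 htend i).mul (𝒳.tendsto_integral_bridgeLaw (i.1 : X) i.2 hFm hM)
  refine hsumlim.congr' ?_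
  filter_upwards [self_mem_nhdsWithin] with γ hγ
  rw [hQ hγ]
  refine (integral_mixture (hp γ).1 fun i => ?_).symm
  have := 𝒳.isProbabilityMeasure_bridgeLaw hγ (i.1 : X) i.2
  exact hint (𝒳.bridgeLaw γ (i.1 : X) i.2)

theorem marginal_zeroMixture (t : unitInterval) {π : K × K → ℝ} (hπ : ∀ i, 0 ≤ π i) (z : X) :
    (marginal (𝒳.zeroMixture K π) t).real {z} =
      ∑ i : K × K, π i * 𝒳.bridgeMass t (i.1 : X) i.2 z := by
  have hb (i : K × K) : 0 ≤ 𝒳.bridgeMass t (i.1 : X) i.2 z :=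
    𝒳.bridgeMass_nonneg t.2.1 t.2.2 _ _ _
  rw [measureReal_def, marginal, Measure.map_apply (measurable_eval t) (measurableSet_singleton z),
    zeroMixture, mixture_apply, ← ENNReal.toReal_ofReal
      (Finset.sum_nonneg fun i _ => mul_nonneg (hπ i) (hb i)),
    ENNReal.ofReal_sum_of_nonneg fun i _ => mul_nonneg (hπ i) (hb i)]
  congr 1
  refine Finset.sum_congr rfl fun i _ => ?_
  rw [ENNReal.ofReal_mul (hπ i), ← 𝒳.zeroBridgeLaw_eval]
  rfl

theorem integral_endpointLaw_zeroMixture {π : K × K → ℝ} (hπ : ∀ i, 0 ≤ π i) (c : X → X → ℝ) :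
    ∫ q, c q.1 q.2 ∂endpointLaw (𝒳.zeroMixture K π) = ∑ i : K × K, π i * c i.1 i.2 := by
  have hae (i : K × K) : (fun ω : PathSpace X => c (ω.eval 0) (ω.eval 1))
      =ᵐ[𝒳.zeroBridgeLaw i.1 i.2]
      fun _ => c i.1 i.2 := by
    filter_upwards [ProbabilityTheory.ae_cond_mem (measurableSet_endpointSet (i.1 : X) i.2)]
      with ω hω
    rw [hω.1, hω.2]
  rw [endpointLaw, integral_map ((measurable_eval 0).prodMk (measurable_eval 1)).aemeasurable
    (measurable_of_countable _).aestronglyMeasurable]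
  refine (integral_mixture hπ fun i => ?_).trans (Finset.sum_congr rfl fun i _ => ?_)
  · have := 𝒳.isProbabilityMeasure_zeroBridgeLaw (i.1 : X) i.2
    exact (integrable_congr (hae i)).2 (integrable_const _)
  · have := 𝒳.isProbabilityMeasure_zeroBridgeLaw (i.1 : X) i.2
    congr 1
    refine (integral_congr_ae (hae i)).trans ?_
    simp

end DiscreteSpace

end ZeroTemp

namespace ZeroTemp

variable {X : Type*}

namespace DiscreteSpace

variable (𝒳 : DiscreteSpace X)

/-! ### The Gibbs measure of a function on a finite set -/

/-- `∑ m e^f` over a finite set. -/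
def partitionFun (K : Finset X) (f : X → ℝ) : ℝ := ∑ x : K, 𝒳.m x * Real.exp (f x)

/-- Weights proportional to `m e^f` on a finite set. -/
def gibbsWeight (K : Finset X) (f : X → ℝ) (x : K) : ℝ :=
  𝒳.m x * Real.exp (f x) / 𝒳.partitionFun K f

theorem partitionFun_pos {K : Finset X} (hK : K.Nonempty) (f : X → ℝ) :
    0 < 𝒳.partitionFun K f := by
  have := hK.to_subtype
  exact Finset.sum_pos (fun x _ => mul_pos (𝒳.m_pos _) (Real.exp_pos _)) Finset.univ_nonempty

theorem gibbsWeight_pos {K : Finset X} (hK : K.Nonempty) (f : X → ℝ) (x : K) :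
    0 < 𝒳.gibbsWeight K f x :=
  div_pos (mul_pos (𝒳.m_pos _) (Real.exp_pos _)) (𝒳.partitionFun_pos hK f)

theorem sum_gibbsWeight {K : Finset X} (hK : K.Nonempty) (f : X → ℝ) :
    ∑ x, 𝒳.gibbsWeight K f x = 1 := by
  simp only [gibbsWeight]
  rw [← Finset.sum_div]
  exact div_self (𝒳.partitionFun_pos hK f).ne'

/-- The logarithmic density is f - log Z, so Gibbs' inequality is attained; hence the choice of
these measures as ν₀ and ν₁. -/
theorem discreteEntropy_gibbsWeight {K : Finset X} (hK : K.Nonempty) (f : X → ℝ) :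
    discreteEntropy (fun x : K => 𝒳.m x) (𝒳.gibbsWeight K f) =
      ∑ x : K, 𝒳.gibbsWeight K f x * f x - Real.log (𝒳.partitionFun K f) := by
  have h (x : K) : 𝒳.gibbsWeight K f x * Real.log (𝒳.gibbsWeight K f x) -
      𝒳.gibbsWeight K f x * Real.log (𝒳.m x) = 𝒳.gibbsWeight K f x * f x -
        𝒳.gibbsWeight K f x * Real.log (𝒳.partitionFun K f) := by
    rw [← mul_sub, ← mul_sub]
    congr 1
    rw [gibbsWeight, Real.log_div (mul_pos (𝒳.m_pos _) (Real.exp_pos _)).ne'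
      (𝒳.partitionFun_pos hK f).ne', Real.log_mul (𝒳.m_pos _).ne' (Real.exp_pos _).ne',
      Real.log_exp]
    ring
  rw [discreteEntropy, Finset.sum_congr rfl fun x _ => h x, Finset.sum_sub_distrib,
    ← Finset.sum_mul, 𝒳.sum_gibbsWeight hK, one_mul]

theorem ofReal_partitionFun (K : Finset X) (f : X → ℝ) :
    ENNReal.ofReal (𝒳.partitionFun K f) =
      ∑ x ∈ K, ENNReal.ofReal (Real.exp (f x)) * ENNReal.ofReal (𝒳.m x) := by
  rw [partitionFun, Finset.sum_coe_sort K fun x => 𝒳.m x * Real.exp (f x),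
    ENNReal.ofReal_sum_of_nonneg fun x _ => mul_nonneg (𝒳.m_pos x).le (Real.exp_pos _).le]
  refine Finset.sum_congr rfl fun x _ => ?_
  rw [mul_comm, ENNReal.ofReal_mul (Real.exp_pos _).le]

theorem pairwise_disjoint_singleton_coe (K : Finset X) :
    Pairwise (Function.onFun Disjoint fun x : K => ({(x : X)} : Set X)) := by
  intro x y hxy
  simpa [Function.onFun] using hxy

end DiscreteSpace

variable [MeasurableSpace X]

/-! ### The reference measure on the discrete space -/

theorem pointMeasure_eq_sum {w : X → ℝ} {T : Finset X} (hT : ∀ x ∉ T, w x = 0) :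
    pointMeasure w = ∑ x ∈ T, ENNReal.ofReal (w x) • Measure.dirac x := by
  ext s hs
  rw [pointMeasure, Measure.sum_apply _ hs, tsum_eq_sum (s := T), Measure.finsetSum_apply]
  intro x hx
  simp [hT x hx]

variable [MeasurableSingletonClass X]

theorem integral_pointMeasure {w : X → ℝ} {T : Finset X} (hw : ∀ x, 0 ≤ w x)
    (hT : ∀ x ∉ T, w x = 0) (h : X → ℝ) : ∫ x, h x ∂pointMeasure w = ∑ x ∈ T, w x * h x := by
  rw [pointMeasure_eq_sum hT, integral_finsetSum_measure]
  · simp [integral_smul_measure, hw]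
  · intro x _
    exact (integrable_dirac (by simp)).smul_measure ENNReal.ofReal_ne_top

theorem pointMeasure_singleton (w : X → ℝ) (x : X) :
    pointMeasure w {x} = ENNReal.ofReal (w x) := by
  rw [pointMeasure, Measure.sum_apply _ (measurableSet_singleton x), tsum_eq_single x]
  · simp
  · intro y hy
    simp [hy]

namespace DiscreteSpace

theorem refMeasure_singleton (𝒳 : DiscreteSpace X) (x : X) :
    𝒳.refMeasure {x} = ENNReal.ofReal (𝒳.m x) :=
  pointMeasure_singleton 𝒳.m x

theorem refMeasure_real_singleton (𝒳 : DiscreteSpace X) (x : X) :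
    𝒳.refMeasure.real {x} = 𝒳.m x := by
  rw [measureReal_def, refMeasure_singleton, ENNReal.toReal_ofReal (𝒳.m_pos x).le]

/-- The probability measure with density proportional to `e^f` on a finite set. -/
def gibbsMeasure (𝒳 : DiscreteSpace X) {K : Finset X} (hK : K.Nonempty) (f : X → ℝ) :
    ProbabilityMeasure X :=
  ⟨mixture (𝒳.gibbsWeight K f) (fun _ => 𝒳.refMeasure) fun x : K => {(x : X)},
    isProbabilityMeasure_mixture (fun x => by simp [refMeasure_singleton, 𝒳.m_pos])
      (fun x => by simp [refMeasure_singleton]) (fun x => (𝒳.gibbsWeight_pos hK f x).le)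
      (𝒳.sum_gibbsWeight hK f)⟩

theorem gibbsMeasure_real_singleton (𝒳 : DiscreteSpace X) {K : Finset X} (hK : K.Nonempty)
    (f : X → ℝ) (x : K) :
    (𝒳.gibbsMeasure hK f : Measure X).real {(x : X)} = 𝒳.gibbsWeight K f x := by
  rw [measureReal_def]
  change (mixture (𝒳.gibbsWeight K f) (fun _ => 𝒳.refMeasure) (fun x : K => {(x : X)})
    {(x : X)}).toReal = _
  rw [mixture_apply_of_disjoint (E := fun x : K => {(x : X)}) (fun x => measurableSet_singleton _)
    (pairwise_disjoint_singleton_coe K) (fun x => by simp [refMeasure_singleton, 𝒳.m_pos])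
    (fun x => by simp [refMeasure_singleton]),
    ENNReal.toReal_ofReal (𝒳.gibbsWeight_pos hK f x).le]

theorem gibbsMeasure_coe (𝒳 : DiscreteSpace X) {K : Finset X} (hK : K.Nonempty) (f : X → ℝ) :
    (𝒳.gibbsMeasure hK f : Measure X) K = 1 := by
  have h : ∀ᵐ x ∂(𝒳.gibbsMeasure hK f : Measure X), x ∈ ⋃ x : K, ({(x : X)} : Set X) :=
    ae_mem_iUnion_mixture fun x : K => measurableSet_singleton (x : X)
  rw [← prob_compl_eq_zero_iff K.measurableSet]
  refine measure_mono_null ?_ (ae_iff.1 h)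
  intro x hx h'
  obtain ⟨y, hy⟩ := mem_iUnion.1 h'
  exact hx (by rw [mem_singleton_iff.1 hy]; exact y.2)

theorem finiteSupport_of_coe_eq_one {K : Finset X} {ν : ProbabilityMeasure X}
    (h : (ν : Measure X) K = 1) : FiniteSupport ν := by
  refine K.finite_toSet.subset fun x hx => ?_
  by_contra hcon
  refine hx (measure_mono_null ?_ ((prob_compl_eq_zero_iff K.measurableSet).2 h))
  simpa using hcon

end DiscreteSpace

variable [Countable X]

theorem lintegral_pointMeasure (w : X → ℝ) (F : X → ENNReal) :
    ∫⁻ x, F x ∂pointMeasure w = ∑' x, F x * ENNReal.ofReal (w x) := by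
  rw [lintegral_countable']
  simp only [pointMeasure_singleton]

namespace DiscreteSpace

variable (𝒳 : DiscreteSpace X)

theorem sigmaFinite_refMeasure : SigmaFinite 𝒳.refMeasure := by
  refine Measure.sigmaFinite_of_countable (countable_range fun x : X => ({x} : Set X)) ?_ ?_
  · rintro _ ⟨x, rfl⟩
    rw [refMeasure_singleton]
    exact ENNReal.ofReal_lt_top
  · ext x
    simp

theorem relEntropy_gibbsMeasure {K : Finset X} (hK : K.Nonempty) (f : X → ℝ) :
    relEntropy (𝒳.gibbsMeasure hK f : Measure X) 𝒳.refMeasure =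
      ((∑ x : K, 𝒳.gibbsWeight K f x * f x - Real.log (𝒳.partitionFun K f) : ℝ) : EReal) := by
  have := 𝒳.sigmaFinite_refMeasure
  rw [← 𝒳.discreteEntropy_gibbsWeight hK]
  refine (relEntropy_mixture 𝒳.refMeasure (fun x : K => {(x : X)})
    (fun x => measurableSet_singleton _) (pairwise_disjoint_singleton_coe K)
    (fun x => by simp [refMeasure_singleton, 𝒳.m_pos]) (fun x => by simp [refMeasure_singleton])
    (fun x => (𝒳.gibbsWeight_pos hK f x).le) (𝒳.sum_gibbsWeight hK f)).trans ?_
  simp only [refMeasure_real_singleton]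

/-! ### The Prékopa–Leindler inequality -/

/-- Gibbs' inequality on T, after coarse-graining to singletons; only an upper bound e on the
entropy is required, which is what convexity supplies. -/
theorem sum_mul_marginal_sub_relEntropy_le {Q : Measure X} [IsProbabilityMeasure Q] {T : Finset X}
    (hQ : Q T = 1) (h : X → ℝ) {e : ℝ} (he : relEntropy Q 𝒳.refMeasure ≤ e) :
    ∑ z : T, Q.real {(z : X)} * h z ≤ e + Real.log (𝒳.partitionFun T h) := by
  have := 𝒳.sigmaFinite_refMeasure
  have hmem : ∀ᵐ x ∂Q, x ∈ ⋃ z : T, ({(z : X)} : Set X) := by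
    filter_upwards [ae_mem_of_measure_eq_one T.measurableSet hQ] with x hx
    exact mem_iUnion.2 ⟨⟨x, hx⟩, rfl⟩
  have hle := (discreteEntropy_le_relEntropy Q 𝒳.refMeasure (fun z : T => {(z : X)})
    (fun x => measurableSet_singleton _) (pairwise_disjoint_singleton_coe T)
    (fun x => by simp [refMeasure_singleton, 𝒳.m_pos]) (fun x => by simp [refMeasure_singleton])
    hmem).trans he
  rw [EReal.coe_le_coe_iff] at hle
  simp only [refMeasure_real_singleton] at hle
  have hsum : ∑ z : T, Q.real {(z : X)} = 1 := sum_subtype_measureReal T ⟨Q, inferInstance⟩ hQ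
  have hgibbs := sum_mul_sub_discreteEntropy_le (r := fun z : T => 𝒳.m z)
    (p := fun z : T => Q.real {(z : X)}) (fun z : T => h z) (fun z => 𝒳.m_pos z)
    (fun z => measureReal_nonneg) hsum
  rw [partitionFun]
  linarith

/-- The logarithmic inequality on finite sets. Convexity between the Gibbs measures of f and g,
Gibbs' inequality for h at time t, and the pointwise hypothesis averaged over π add up to it. -/
theorem exists_finset_log_partitionFun_le
    (c : unitInterval → X → X → ℝ)
    (C : unitInterval → ProbabilityMeasure X → ProbabilityMeasure X → ℝ)
    (hC : ∀ ν₀ ν₁ : ProbabilityMeasure X, FiniteSupport ν₀ → FiniteSupport ν₁ →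
      ∀ Q₀ : ProbabilityMeasure (PathSpace X), 𝒳.IsLimitOptimizer ν₀ ν₁ Q₀ →
      ∀ t : unitInterval, 0 < t → t < 1 →
        C t ν₀ ν₁ = ∫ p, c t p.1 p.2 ∂endpointLaw (Q₀ : Measure (PathSpace X)))
    (hconv : 𝒳.DisplacementConvex C)
    (t : unitInterval) (ht0 : 0 < t) (ht1 : t < 1) (f g h : X → ℝ)
    (hfgh : ∀ x y : X, (1 - t : ℝ) * f x + (t : ℝ) * g y ≤
      (∫ z, h z ∂𝒳.bridge t x y) + (t : ℝ) * (1 - t) / 2 * c t x y)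
    {K : Finset X} (hK : K.Nonempty) :
    ∃ T : Finset X, T.Nonempty ∧ (1 - t : ℝ) * Real.log (𝒳.partitionFun K f) +
      t * Real.log (𝒳.partitionFun K g) ≤ Real.log (𝒳.partitionFun T h) := by
  set ν₀ := 𝒳.gibbsMeasure hK f with hν₀
  set ν₁ := 𝒳.gibbsMeasure hK g with hν₁
  have h0 : (ν₀ : Measure X) K = 1 := 𝒳.gibbsMeasure_coe hK f
  have h1 : (ν₁ : Measure X) K = 1 := 𝒳.gibbsMeasure_coe hK g
  obtain ⟨π, hπ, Q₀, hQ₀, hopt⟩ := 𝒳.exists_isLimitOptimizer h0 h1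
  have hC' := hC ν₀ ν₁ (finiteSupport_of_coe_eq_one h0) (finiteSupport_of_coe_eq_one h1) Q₀ hopt
    t ht0 ht1
  have hent := hconv ν₀ ν₁ (finiteSupport_of_coe_eq_one h0) (finiteSupport_of_coe_eq_one h1) Q₀ hopt
    t ht0 ht1
  rw [hC', hQ₀, 𝒳.integral_endpointLaw_zeroMixture hπ.1, hν₀, hν₁, relEntropy_gibbsMeasure,
    relEntropy_gibbsMeasure, ← EReal.coe_mul, ← EReal.coe_mul, ← EReal.coe_add,
    ← EReal.coe_sub] at hent
  classical
  -- All intermediate positions lie on geodesics between points of K, and intervals are finite; so T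
  -- carries the marginal at time t.
  set T : Finset X := (Finset.univ : Finset (K × K)).biUnion fun i =>
    (𝒳.finite_interval (i.1 : X) i.2).toFinset with hT
  have hbT (i : K × K) (z : X) (hz : z ∉ T) : 𝒳.bridgeMass t (i.1 : X) i.2 z = 0 := by
    refine 𝒳.bridgeMass_eq_zero fun hcon => hz ?_
    exact Finset.mem_biUnion.2 ⟨i, Finset.mem_univ i, by simpa using hcon⟩
  have hb (x y z : X) : 0 ≤ 𝒳.bridgeMass t x y z := 𝒳.bridgeMass_nonneg t.2.1 t.2.2 x y z
  have hprob : IsProbabilityMeasure (marginal (𝒳.zeroMixture K π) t) := by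
    have := 𝒳.isProbabilityMeasure_zeroMixture hπ.1
      (sum_eq_one_of_mem_couplings (sum_subtype_measureReal K ν₀ h0) hπ)
    exact Measure.isProbabilityMeasure_map (measurable_eval t).aemeasurable
  have hmarg := 𝒳.marginal_zeroMixture t hπ.1
  have hTone : marginal (𝒳.zeroMixture K π) t T = 1 := by
    rw [← prob_compl_eq_zero_iff T.measurableSet, ← biUnion_of_singleton ((T : Set X)ᶜ),
      measure_biUnion_null_iff (to_countable _)]
    intro z hz
    rw [← measureReal_eq_zero_iff, hmarg]
    exact Finset.sum_eq_zero fun i _ => by rw [hbT i z hz, mul_zero]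
  have hTne : T.Nonempty := by
    rw [Finset.nonempty_iff_ne_empty]
    intro hcon
    rw [hcon] at hTone
    simp at hTone
  refine ⟨T, hTne, ?_⟩
  have hgibbs := 𝒳.sum_mul_marginal_sub_relEntropy_le hTone h hent
  have hh : ∑ z : T, (marginal (𝒳.zeroMixture K π) t).real {(z : X)} * h z =
      ∑ i : K × K, π i * ∫ z, h z ∂𝒳.bridge t (i.1 : X) i.2 := by
    simp only [hmarg, Finset.sum_mul]
    rw [Finset.sum_comm]
    refine Finset.sum_congr rfl fun i _ => ?_
    rw [bridge, integral_pointMeasure (hb _ _) (hbT i), ← Finset.sum_coe_sort T, Finset.mul_sum]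
    exact Finset.sum_congr rfl fun z _ => by ring
  have hf : ∑ i : K × K, π i * f i.1 = ∑ x : K, 𝒳.gibbsWeight K f x * f x := by
    rw [Fintype.sum_prod_type]
    refine Finset.sum_congr rfl fun x _ => ?_
    have hx : ∑ y, π (x, y) = 𝒳.gibbsWeight K f x :=
      (hπ.2.1 x).trans (𝒳.gibbsMeasure_real_singleton hK f x)
    rw [← hx, Finset.sum_mul]
  have hg : ∑ i : K × K, π i * g i.2 = ∑ x : K, 𝒳.gibbsWeight K g x * g x := by
    rw [Fintype.sum_prod_type_right]
    refine Finset.sum_congr rfl fun y _ => ?_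
    have hy : ∑ x, π (x, y) = 𝒳.gibbsWeight K g y :=
      (hπ.2.2 y).trans (𝒳.gibbsMeasure_real_singleton hK g y)
    rw [← hy, Finset.sum_mul]
  -- The hypothesis on f, g, h averaged over π; its cost term is exactly the one subtracted by
  -- convexity.
  have hsum : (1 - t : ℝ) * ∑ i : K × K, π i * f i.1 + t * ∑ i : K × K, π i * g i.2 ≤
      ∑ i : K × K, π i * ∫ z, h z ∂𝒳.bridge t (i.1 : X) i.2 +
        (t : ℝ) * (1 - t) / 2 * ∑ i : K × K, π i * c t i.1 i.2 := by
    simp only [Finset.mul_sum, ← Finset.sum_add_distrib]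
    refine Finset.sum_le_sum fun i _ => ?_
    have := mul_le_mul_of_nonneg_left (hfgh i.1 i.2) (hπ.1 i)
    linarith
  rw [hf, hg] at hsum
  rw [hh] at hgibbs
  linarith

theorem lintegral_exp_refMeasure (f : X → ℝ) :
    ∫⁻ x, ENNReal.ofReal (Real.exp (f x)) ∂𝒳.refMeasure =
      ∑' x, ENNReal.ofReal (Real.exp (f x)) * ENNReal.ofReal (𝒳.m x) :=
  lintegral_pointMeasure _ _

theorem ofReal_partitionFun_le (K : Finset X) (f : X → ℝ) :
    ENNReal.ofReal (𝒳.partitionFun K f) ≤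
      ∫⁻ x, ENNReal.ofReal (Real.exp (f x)) ∂𝒳.refMeasure := by
  rw [ofReal_partitionFun, lintegral_exp_refMeasure]
  exact ENNReal.sum_le_tsum K

theorem tendsto_ofReal_partitionFun (f : X → ℝ) :
    Tendsto (fun K : Finset X => ENNReal.ofReal (𝒳.partitionFun K f)) atTop
      (𝓝 (∫⁻ x, ENNReal.ofReal (Real.exp (f x)) ∂𝒳.refMeasure)) := by
  simp only [ofReal_partitionFun, lintegral_exp_refMeasure]
  exact ENNReal.summable.hasSum

theorem lintegral_exp_refMeasure_ne_zero (f : X → ℝ) :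
    ∫⁻ x, ENNReal.ofReal (Real.exp (f x)) ∂𝒳.refMeasure ≠ 0 := by
  obtain ⟨x⟩ := 𝒳.connected.nonempty
  have h := 𝒳.ofReal_partitionFun_le {x} f
  have h2 := 𝒳.partitionFun_pos (Finset.singleton_nonempty x) f
  exact ((ENNReal.ofReal_pos.2 h2).trans_le h).ne'

end DiscreteSpace

end ZeroTemp

end

/-! ### Passage from finite sets to the whole space. -/

theorem mainTheorem8 {X : Type*} [Countable X] [MeasurableSpace X] [MeasurableSingletonClass X]
    (𝒳 : ZeroTemp.DiscreteSpace X)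
    (c : unitInterval → X → X → ℝ)
    (C : unitInterval → ProbabilityMeasure X → ProbabilityMeasure X → ℝ)
    (hC : ∀ ν₀ ν₁ : ProbabilityMeasure X,
      ZeroTemp.DiscreteSpace.FiniteSupport ν₀ → ZeroTemp.DiscreteSpace.FiniteSupport ν₁ →
      ∀ Q₀ : ProbabilityMeasure (ZeroTemp.PathSpace X), 𝒳.IsLimitOptimizer ν₀ ν₁ Q₀ →
      ∀ t : unitInterval, 0 < t → t < 1 →
        C t ν₀ ν₁ = ∫ p, c t p.1 p.2 ∂ZeroTemp.endpointLaw (Q₀ : Measure (ZeroTemp.PathSpace X)))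
    (hconv : 𝒳.DisplacementConvex C)
    (t : unitInterval) (ht0 : 0 < t) (ht1 : t < 1)
    (f g h : X → ℝ)
    (hfgh : ∀ x y : X, (1 - t : ℝ) * f x + (t : ℝ) * g y ≤
      (∫ z, h z ∂𝒳.bridge t x y) + (t : ℝ) * (1 - t) / 2 * c t x y) :
    (∫⁻ x, ENNReal.ofReal (Real.exp (f x)) ∂𝒳.refMeasure) ^ (1 - t : ℝ) *
        (∫⁻ x, ENNReal.ofReal (Real.exp (g x)) ∂𝒳.refMeasure) ^ (t : ℝ) ≤
      ∫⁻ x, ENNReal.ofReal (Real.exp (h x)) ∂𝒳.refMeasure := by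
  have ht0' : (0 : ℝ) < t := ht0
  have ht1' : (0 : ℝ) < 1 - t := sub_pos.2 ht1
  -- Multiplication in `ENNReal` is discontinuous only at 0 · ∞, and the integrals may be infinite;
  -- nonvanishing factors make the limit of the product legitimate.
  have hne (u : X → ℝ) {s : ℝ} (hs : 0 < s) :
      (∫⁻ x, ENNReal.ofReal (Real.exp (u x)) ∂𝒳.refMeasure) ^ s ≠ 0 := by
    rw [ne_eq, ENNReal.rpow_eq_zero_iff_of_pos hs]
    exact 𝒳.lintegral_exp_refMeasure_ne_zero u
  have hlim := ENNReal.Tendsto.mul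
    ((ENNReal.continuous_rpow_const (y := (1 - t : ℝ))).tendsto _ |>.comp
      (𝒳.tendsto_ofReal_partitionFun f)) (Or.inl (hne f ht1'))
    ((ENNReal.continuous_rpow_const (y := (t : ℝ))).tendsto _ |>.comp
      (𝒳.tendsto_ofReal_partitionFun g)) (Or.inl (hne g ht0'))
  refine le_of_tendsto hlim ?_
  obtain ⟨x₀⟩ := 𝒳.connected.nonempty
  -- Large K contain a fixed vertex, hence are nonempty and have normalizable Gibbs weights.
  filter_upwards [eventually_ge_atTop ({x₀} : Finset X)] with K hK
  have hKne : K.Nonempty := ⟨x₀, hK (Finset.mem_singleton_self x₀)⟩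
  obtain ⟨T, hT, hle⟩ :=
    𝒳.exists_finset_log_partitionFun_le c C hC hconv t ht0 ht1 f g h hfgh hKne
  refine le_trans ?_ (𝒳.ofReal_partitionFun_le T h)
  have hA := 𝒳.partitionFun_pos hKne f
  have hB := 𝒳.partitionFun_pos hKne g
  have hZ := 𝒳.partitionFun_pos hT h
  simp only [Function.comp_apply]
  rw [ENNReal.ofReal_rpow_of_pos hA, ENNReal.ofReal_rpow_of_pos hB,
    ← ENNReal.ofReal_mul (Real.rpow_pos_of_pos hA _).le]
  refine ENNReal.ofReal_le_ofReal ?_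
  rw [← Real.log_le_log_iff (mul_pos (Real.rpow_pos_of_pos hA _) (Real.rpow_pos_of_pos hB _)) hZ,
    Real.log_mul (Real.rpow_pos_of_pos hA _).ne' (Real.rpow_pos_of_pos hB _).ne',
    Real.log_rpow hA, Real.log_rpow hB]
  exact hle
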